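/- Let $n\ge 0$ and let $A\in(\mathbb R\cup\{-\infty\})^{n\times n}$ be any square matrix over the max-plus semiring ($a\oplus b=\max(a,b)$, $a\otimes b=a+b$; matrix products and powers are max-plus, $A^0=I$, and $x^{\otimes t}=t\cdot x$). **Digraphs.** The digraph $\mathcal D(A)$ has nodes $1,\dots,n$ and an edge $(i,j)$ of weight $a_{ij}$ whenever $a_{ij}\ne-\infty$. A path is a walk (possibly of length $0$) without repeated nodes; a cycle is a closed walk of positive length whose only repetition is that its ends coincide. For a digraph $\mathcal D$, $\mathrm{cr}(\mathcal D)$ is the greatest length of a cycle (circumference, $0$ if there is none) and $\mathrm{cd}(\mathcal D)$ the greatest length of a path (cab driver's diameter). For a strongly connected component (s.c.c.), its girth is its shortest cycle length and its cyclicity the gcd of the lengths of its closed walks; the cyclicity of a digraph is the lcm of the cyclicities of its s.c.c.'s. **Critical graph.** $\lambda(A)$ is the maximum of weight/length over the cycles of $\mathcal D(A)$ ($-\infty$ if there is none). The critical graph $\mathcal G^c(A)$ consists of the nodes and edges of the nonempty closed walks of $\mathcal D(A)$ with mean weight $\lambda(A)$. Let $n_c$ be its number of nodes, and $\hat g$,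 $\hat\gamma$ the greatest girth and the greatest cyclicity of its s.c.c.'s (both $0$ if it is empty). For a node $i$ of $\mathcal G^c(A)$ let $\gamma_i$ be the cyclicity of its s.c.c. in $\mathcal G^c(A)$; let $\mathrm{ep}(i)$ be the least $T\in\mathbb N$ such that for every multiple $t\ge T$ of $\gamma_i$ there is a closed walk of length $t$ at $i$ in $\mathcal G^c(A)$, and let $\overline{\mathrm{ep}}(i)$ be the least such $T$ that is itself a multiple of $\gamma_i$. Let $\mathrm{ep}$ (the exploration penalty of $\mathcal G^c(A)$) and $\overline{\mathrm{ep}}$ be the maxima of $\mathrm{ep}(i)$ and $\overline{\mathrm{ep}}(i)$ over the critical nodes $i$ ($0$ if there is none). **CSR terms.** Let $\mathcal G$ be any representing subgraph of $\mathcal G^c(A)$, i.e. a subgraph without trivial s.c.c.'s, without edges between distinct s.c.c.'s, and such that every s.c.c. of $\mathcal G^c(A)$ contains exactly one s.c.c. of $\mathcal G$ (for instance $\mathcal G=\mathcal G^c(A)$); let $\gamma(\mathcal G)$ be its cyclicity. Put $M=\bigoplus_{k\ge0}\big((-\lambda(A))\otimes A\big)^{k\gamma(\mathcal G)}$. Then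 $C$ (resp. $R$) agrees with $M$ in the columns (resp. rows) with index in $\mathcal G$, $S$ agrees with $(-\lambda(A))\otimes A$ at the edges of $\mathcal G$, and all their other entries are $-\infty$. (If $\lambda(A)=-\infty$, then $\mathcal G^c(A)$ is empty and $C,S,R$ have all entries $-\infty$.) For a matrix $B$, the weak CSR threshold $T_1(A,B)$ is the smallest $T\in\mathbb N$ such that $$A^t=\big(\lambda(A)^{\otimes t}\otimes CS^tR\big)\oplus B^t\qquad\text{for all }t\ge T .$$ **The schemes.** For a set $D$ of nodes, let $A\setminus D$ denote $A$ with all entries in rows and columns with index in $D$ replaced by $-\infty$. * Nachtigall scheme: $B=A\setminus D$ with $D$ the set of nodes of $\mathcal G^c(A)$. * Hartmann–Arguelles scheme: let $V$ be a max-balancing of $A$, i.e. $v_{ij}=-x_i+a_{ij}+x_j$ for some $x\in\mathbb R^n$, $v_{ij}\le\lambda(A)$ for all $i,j$, with equality at the critical edges, and every edge $(i,j)$ of $\mathcal D(V)$ that lies on a cycle lies on a cycle all of whose edges have weight at least $v_{ij}$. For $\mu\in\mathbb R\cup\{-\infty\}$ let $\mathrm{Th}(\mu)$ be the graph of the edges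 $(i,j)$ of $\mathcal D(V)$ with $v_{ij}\ge\mu$, and let $\mu^{ha}$ be the maximal $\mu\le\lambda(A)$ such that $\mathrm{Th}(\mu)$ has an s.c.c. containing a cycle but no s.c.c. of $\mathcal G^c(A)$ ($\mu^{ha}=-\infty$ if there is none). Then $B=A\setminus D$, where $D$ is the set of nodes of the s.c.c.'s of $\mathrm{Th}(\mu^{ha})$ that meet $\mathcal G^c(A)$. **Theorem.** Let $B$ be the matrix of the Nachtigall scheme, or of the Hartmann–Arguelles scheme for some max-balancing of $A$. Then $T_1(A,B)$ exists and, with $\mathrm{cr}=\mathrm{cr}(\mathcal D(A))$ and $\mathrm{cd}=\mathrm{cd}(\mathcal D(A))$, $$\begin{aligned} T_1(A,B)&\le \mathrm{Wi}(n),\qquad \mathrm{Wi}(n)=0\text{ for }n\le1,\ \mathrm{Wi}(n)=(n-1)^2+1\text{ for }n>1,\\ T_1(A,B)&\le \hat g\,(n-2)+n,\\ T_1(A,B)&\le (\hat g-1)(\mathrm{cr}-1)+(\hat g+1)\,\mathrm{cd},\\ T_1(A,B)&\le \hat\gamma\,(n-1)+n-n_c+\overline{\mathrm{ep}},\\ T_1(A,B)&\le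 (\hat\gamma-1)(\mathrm{cr}-1)+(\hat\gamma+1)\,\mathrm{cd}+\mathrm{ep}. \end{aligned}$$ -/

import Mathlib

noncomputable section

namespace MaxPlus

/-- The max-plus product of two matrices. The max-plus semiring is `WithBot ℝ` with zero
`⊥ = -∞`, sum `x ⊕ y = max x y` and product `x ⊗ y = x + y`. -/
def mul {n : ℕ} (A B : Matrix (Fin n) (Fin n) (WithBot ℝ)) :
    Matrix (Fin n) (Fin n) (WithBot ℝ) :=
  Matrix.of fun i j => Finset.univ.sup fun k => A i k + B k j

/-- The max-plus sum of two matrices: the entrywise maximum. -/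
def add {n : ℕ} (A B : Matrix (Fin n) (Fin n) (WithBot ℝ)) :
    Matrix (Fin n) (Fin n) (WithBot ℝ) :=
  Matrix.of fun i j => max (A i j) (B i j)

/-- The max-plus multiple `c ⊗ A` of a matrix. -/
def scale {n : ℕ} (c : WithBot ℝ) (A : Matrix (Fin n) (Fin n) (WithBot ℝ)) :
    Matrix (Fin n) (Fin n) (WithBot ℝ) :=
  Matrix.of fun i j => c + A i j

/-- The max-plus identity matrix: `0` on the diagonal, `-∞` elsewhere. -/
def one (n : ℕ) : Matrix (Fin n) (Fin n) (WithBot ℝ) :=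
  Matrix.of fun i j => if i = j then 0 else ⊥

/-- The max-plus power `A^t`. -/
def pow {n : ℕ} (A : Matrix (Fin n) (Fin n) (WithBot ℝ)) :
    ℕ → Matrix (Fin n) (Fin n) (WithBot ℝ)
  | 0 => one n
  | t + 1 => mul (pow A t) A

/-- The Kleene star `I ⊕ A ⊕ A² ⊕ ⋯`, entrywise as a supremum. -/
def star {n : ℕ} (A : Matrix (Fin n) (Fin n) (WithBot ℝ)) :
    Matrix (Fin n) (Fin n) (WithBot ℝ) :=
  Matrix.of fun i j => ⨆ t : ℕ, pow A t i j

/-- The max-plus inverse `μ⁻ = -μ` of a finite scalar (the value at `-∞` is immaterial). -/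
def inv (μ : WithBot ℝ) : WithBot ℝ := WithBot.map (fun x : ℝ => -x) μ

/-! ### Digraphs and walks -/

/-- Walks in a digraph. -/
inductive Walk {V : Type} (G : Digraph V) : V → V → Type
  | nil (i : V) : Walk G i i
  | cons {i j k : V} (h : G.Adj i j) (p : Walk G j k) : Walk G i k

namespace Walk

variable {V : Type} {G : Digraph V}

/-- The number of edges of a walk. -/
def length : {i j : V} → Walk G i j → ℕ
  | _, _, nil _ => 0
  | _, _, cons _ p => p.length + 1

/-- The sequence of nodes of a walk, both ends included. -/
def support : {i j : V} → Walk G i j → List V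
  | _, _, nil i => [i]
  | i, _, cons _ p => i :: p.support

/-- The sequence of edges of a walk. -/
def edges : {i j : V} → Walk G i j → List (V × V)
  | _, _, nil _ => []
  | i, _, @cons _ _ _ j _ _ p => (i, j) :: p.edges

/-- A path visits no node twice. -/
def IsPath {i j : V} (p : Walk G i j) : Prop := p.support.Nodup

/-- A (nonempty) cycle is a closed walk of positive length whose only repetition is that
its two ends coincide; loops are cycles of length one. -/
def IsCycle {i : V} (p : Walk G i i) : Prop := 0 < p.length ∧ p.support.tail.Nodup

end Walk

/-- The weight of a walk for the matrix `A`: the (max-plus product, i.e.) sum of the entries of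
`A` along its edges, with multiplicity. -/
def weight {n : ℕ} (A : Matrix (Fin n) (Fin n) (WithBot ℝ)) {G : Digraph (Fin n)}
    {i j : Fin n} (p : Walk G i j) : WithBot ℝ :=
  (p.edges.map fun e => A e.1 e.2).sum

/-- The digraph of a matrix: its edges are the positions of the finite entries. -/
def digraph {n : ℕ} (A : Matrix (Fin n) (Fin n) (WithBot ℝ)) : Digraph (Fin n) where
  Adj i j := A i j ≠ ⊥

/-- The nodes of a digraph that is given (induced) by its edges. -/
def IsNode {V : Type} (G : Digraph V) (i : V) : Prop := ∃ j, G.Adj i j ∨ G.Adj j i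

/-- `i` and `j` are mutually reachable in `G`. The nodes that are mutually reachable with a
node `i` are the nodes of the strongly connected component (s.c.c.) of `i`. -/
def SameScc {V : Type} (G : Digraph V) (i j : V) : Prop :=
  Nonempty (Walk G i j) ∧ Nonempty (Walk G j i)

/-- The greatest length of a cycle (`0` if there is none). -/
def circumference {n : ℕ} (G : Digraph (Fin n)) : ℕ :=
  sSup {L | ∃ (i : Fin n) (p : Walk G i i), p.IsCycle ∧ p.length = L}

/-- The cab driver's diameter: the greatest length of a path. -/
def cabDriverDiameter {n : ℕ} (G : Digraph (Fin n)) : ℕ :=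
  sSup {L | ∃ (i j : Fin n) (p : Walk G i j), p.IsPath ∧ p.length = L}

/-- The girth of the s.c.c. of `i`: the length of its shortest cycle. -/
def sccGirth {n : ℕ} (G : Digraph (Fin n)) (i : Fin n) : ℕ :=
  sInf {L | ∃ (k : Fin n) (p : Walk G k k), SameScc G i k ∧ p.IsCycle ∧ p.length = L}

/-- The cyclicity of the s.c.c. of `i`: the greatest common divisor of the lengths of its
closed walks. -/
def sccCyclicity {n : ℕ} (G : Digraph (Fin n)) (i : Fin n) : ℕ :=
  sSup {d | ∀ (k : Fin n) (p : Walk G k k), SameScc G i k → d ∣ p.length}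

open scoped Classical in
/-- The number of nodes of `G`. -/
def nodeCount {n : ℕ} (G : Digraph (Fin n)) : ℕ :=
  (Finset.univ.filter fun i => IsNode G i).card

open scoped Classical in
/-- The cyclicity of `G`: the least common multiple of the cyclicities of its s.c.c.'s. -/
def cyclicity {n : ℕ} (G : Digraph (Fin n)) : ℕ :=
  (Finset.univ.filter fun i => IsNode G i).lcm (sccCyclicity G)

open scoped Classical in
/-- The greatest girth of an s.c.c. of `G` (`0` if `G` has no node). -/
def maxGirth {n : ℕ} (G : Digraph (Fin n)) : ℕ :=
  (Finset.univ.filter fun i => IsNode G i).sup (sccGirth G)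

open scoped Classical in
/-- The greatest cyclicity of an s.c.c. of `G` (`0` if `G` has no node). -/
def maxCyclicity {n : ℕ} (G : Digraph (Fin n)) : ℕ :=
  (Finset.univ.filter fun i => IsNode G i).sup (sccCyclicity G)

/-- The exploration penalty of a node for the modulus `γ`: the least `T` such that there is a
closed walk of length `t` at `i` for every multiple `t ≥ T` of `γ`. -/
def nodeExplorationPenalty {n : ℕ} (G : Digraph (Fin n)) (γ : ℕ) (i : Fin n) : ℕ :=
  sInf {T | ∀ t, γ ∣ t → T ≤ t → ∃ p : Walk G i i, p.length = t}

/-- The variant of the exploration penalty in which `T` itself is a multiple of `γ`. -/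
def nodeRoundedExplorationPenalty {n : ℕ} (G : Digraph (Fin n)) (γ : ℕ) (i : Fin n) : ℕ :=
  sInf {T | γ ∣ T ∧ ∀ t, γ ∣ t → T ≤ t → ∃ p : Walk G i i, p.length = t}

open scoped Classical in
/-- The exploration penalty of `G`: the maximum over the s.c.c.'s of `G`, and over their nodes, of
the node penalty for the cyclicity of the s.c.c. -/
def explorationPenalty {n : ℕ} (G : Digraph (Fin n)) : ℕ :=
  (Finset.univ.filter fun i => IsNode G i).sup
    fun i => nodeExplorationPenalty G (sccCyclicity G i) i

open scoped Classical in
/-- The same maximum for the variant with multiples of the cyclicity. -/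
def roundedExplorationPenalty {n : ℕ} (G : Digraph (Fin n)) : ℕ :=
  (Finset.univ.filter fun i => IsNode G i).sup
    fun i => nodeRoundedExplorationPenalty G (sccCyclicity G i) i

/-- The Wielandt number. -/
def wielandt (n : ℕ) : ℕ := if n ≤ 1 then 0 else (n - 1) ^ 2 + 1

/-! ### The maximum cycle mean, the critical graph, and CSR terms -/

/-- The maximum cycle mean `λ(A)`: the greatest `x` whose max-plus power `x^{⊗ L} = L • x` is the
weight of a cycle of length `L`; it is `-∞` if there is no cycle. -/
def maxCycleMean {n : ℕ} (A : Matrix (Fin n) (Fin n) (WithBot ℝ)) : WithBot ℝ :=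
  sSup {x | ∃ (i : Fin n) (p : Walk (digraph A) i i), p.IsCycle ∧ p.length • x = weight A p}

/-- The critical graph: its edges (and nodes) are those of the nonempty closed walks in the
digraph of `A` whose mean weight is `λ(A)`. -/
def criticalGraph {n : ℕ} (A : Matrix (Fin n) (Fin n) (WithBot ℝ)) : Digraph (Fin n) where
  Adj i j := ∃ (k : Fin n) (p : Walk (digraph A) k k),
    0 < p.length ∧ weight A p = p.length • maxCycleMean A ∧ (i, j) ∈ p.edges

/-- `G` is a representing subgraph of `H`: it is a subgraph without trivial s.c.c. and without
edges between distinct s.c.c.'s, and every s.c.c. of `H` contains exactly one s.c.c. of `G`. -/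
def IsRepresenting {n : ℕ} (G H : Digraph (Fin n)) : Prop :=
  G ≤ H ∧ (∀ i j, G.Adj i j → SameScc G i j) ∧
    ∀ i, IsNode H i → ∃ k, IsNode G k ∧ SameScc H i k ∧
      ∀ l, IsNode G l → SameScc H i l → SameScc G k l

section CSR

variable {n : ℕ} (A : Matrix (Fin n) (Fin n) (WithBot ℝ)) (G : Digraph (Fin n))

/-- The matrix `M = ((λ(A)⁻ ⊗ A)^γ)^*`, where `γ` is the cyclicity of `G`. -/
def csrM : Matrix (Fin n) (Fin n) (WithBot ℝ) :=
  star (pow (scale (inv (maxCycleMean A)) A) (cyclicity G))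

open scoped Classical in
/-- The columns of `M` at the nodes of `G`. -/
def csrC : Matrix (Fin n) (Fin n) (WithBot ℝ) :=
  Matrix.of fun i j => if IsNode G j then csrM A G i j else ⊥

open scoped Classical in
/-- The entries of `λ(A)⁻ ⊗ A` at the edges of `G`. -/
def csrS : Matrix (Fin n) (Fin n) (WithBot ℝ) :=
  Matrix.of fun i j => if G.Adj i j then inv (maxCycleMean A) + A i j else ⊥

open scoped Classical in
/-- The rows of `M` at the nodes of `G`. -/
def csrR : Matrix (Fin n) (Fin n) (WithBot ℝ) :=
  Matrix.of fun i j => if IsNode G i then csrM A G i j else ⊥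

/-- `T` is the weak CSR threshold `T₁(A, B)`, for the CSR terms of `A` with respect to `G`: the
smallest `T` such that `A^t = (λ(A)^{⊗ t} ⊗ C S^t R) ⊕ B^t` for all `t ≥ T`. -/
def IsWeakCSRThreshold (B : Matrix (Fin n) (Fin n) (WithBot ℝ)) (T : ℕ) : Prop :=
  IsLeast {T : ℕ | ∀ t, T ≤ t → pow A t =
    add (scale (t • maxCycleMean A) (mul (mul (csrC A G) (pow (csrS A G) t)) (csrR A G)))
      (pow B t)} T

end CSR

/-! ### The two schemes -/

open scoped Classical in
/-- The matrix obtained from `A` by setting to `-∞` all entries in the rows and columns with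
index in `D`. -/
def deleteNodes {n : ℕ} (A : Matrix (Fin n) (Fin n) (WithBot ℝ)) (D : Set (Fin n)) :
    Matrix (Fin n) (Fin n) (WithBot ℝ) :=
  Matrix.of fun i j => if i ∈ D ∨ j ∈ D then ⊥ else A i j

/-- The matrix `B` of the Nachtigall scheme. -/
def nachtigall {n : ℕ} (A : Matrix (Fin n) (Fin n) (WithBot ℝ)) :
    Matrix (Fin n) (Fin n) (WithBot ℝ) :=
  deleteNodes A {i | IsNode (criticalGraph A) i}

/-- `V` is a max-balancing of `A`: a diagonal rescaling `V = D⁻ A D` with finite diagonal `D`, all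
of whose entries are at most `λ(A)`, with equality at the critical edges, and which satisfies the
cycle cover property: each edge that lies on a cycle lies on a cycle all of whose edges have at
least its weight. (If the digraph of `A` is completely reducible, every edge lies on a cycle;
otherwise the edges between distinct strongly connected components do not, and no cycle could
cover them.) -/
def IsMaxBalancing {n : ℕ} (A V : Matrix (Fin n) (Fin n) (WithBot ℝ)) : Prop :=
  (∃ x : Fin n → ℝ, ∀ i j, V i j = ((-x i : ℝ) : WithBot ℝ) + A i j + (x j : WithBot ℝ)) ∧
  (∀ i j, V i j ≤ maxCycleMean A) ∧
  (∀ i j, (criticalGraph A).Adj i j → V i j = maxCycleMean A) ∧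
  ∀ i j, (∃ (k : Fin n) (p : Walk (digraph V) k k), p.IsCycle ∧ (i, j) ∈ p.edges) →
    ∃ (k : Fin n) (p : Walk (digraph V) k k), p.IsCycle ∧ (i, j) ∈ p.edges ∧
      ∀ e ∈ p.edges, V i j ≤ V e.1 e.2

/-- The Hartmann-Arguelles threshold graph: the edges of `V` of weight at least `μ`. -/
def haGraph {n : ℕ} (V : Matrix (Fin n) (Fin n) (WithBot ℝ)) (μ : WithBot ℝ) :
    Digraph (Fin n) where
  Adj i j := V i j ≠ ⊥ ∧ μ ≤ V i j

/-- `μ^{ha}`: the maximum of the `μ ≤ λ(A)` for which the threshold graph has a (nontrivial) s.c.c.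
that contains no s.c.c. of the critical graph, and `-∞` if there is no such `μ`. A node is in a
nontrivial s.c.c. if it lies on a cycle; in a completely reducible threshold graph all nodes
do. -/
def haThreshold {n : ℕ} (A V : Matrix (Fin n) (Fin n) (WithBot ℝ)) : WithBot ℝ :=
  sSup {μ | μ ≤ maxCycleMean A ∧
    ∃ i, (∃ p : Walk (haGraph V μ) i i, 0 < p.length) ∧
      ¬ ∃ k, IsNode (criticalGraph A) k ∧
        ∀ l, SameScc (criticalGraph A) k l → SameScc (haGraph V μ) i l}

/-- The matrix `B` of the Hartmann-Arguelles scheme for the max-balancing `V` of `A`: the deleted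
nodes are those of the s.c.c.'s of the threshold graph at `μ^{ha}` that meet the critical
graph. -/
def hartmannArguelles {n : ℕ} (A V : Matrix (Fin n) (Fin n) (WithBot ℝ)) :
    Matrix (Fin n) (Fin n) (WithBot ℝ) :=
  deleteNodes A {i | ∃ k, IsNode (criticalGraph A) k ∧
    SameScc (haGraph V (haThreshold A V)) i k}

end MaxPlus

end

/-! An entry of `A^t` is the greatest weight of a walk of length `t`. When `λ(A)` is finite,
subtracting it and adding a potential makes all edge weights nonpositive and all critical edges
zero, so walks inside the critical graph are free. In these terms an entry of `λ^t ⊗ C S^t R` is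
governed by the walks through a node of `G` whose length is `t` modulo the cyclicity of its critical
component. The expansion at time `t` thus follows from two facts about walks.

`CanAdjust`: a walk through a critical node `z`, of length congruent to `t` modulo the cyclicity at
`z`, can be replaced by one of length exactly `t` through some critical node, without loss of
weight. This gives `CSR ≤ A^t` (`csr_le`). `IsDominated`: a walk of length `t` that meets a deleted
node is no heavier than some walk of length `t` through a critical node. Such walks lie below the
CSR term (`le_csr`), and the remaining walks are those of `B`.

Adjusting is cutting followed by refilling. Among any `m` closed subwalks some nonempty selection
has total length divisible by `m` (pigeonhole on prefix sums). Removing it loses no weight and keeps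
the length class, so a shortest walk of its class has few closed subwalks and is short. Its length
is bounded by counting visits to each node (`length_le_of_minimal`) or by cutting it into blocks too
long to be paths (`exists_walkThrough_le_cabDriverDiameter`). The gap up to `t` is filled with free
closed walks: copies of a shortest critical cycle when `m` is the girth, or a closed walk supplied
by the exploration penalty when `m` is the cyclicity. The girth bound yields the Wielandt number
unless the girth is `n`. In that case the critical cycle is Hamiltonian and a separate argument
(`exists_short_walk`) keeps fewer than `n` edges of the walk and joins them by arcs of the cycle.

Domination is trivial for Nachtigall's scheme. For Hartmann and Arguelles it follows from
`CanAdjust` itself, applied to the balanced weights capped at a suitable level, for which a detour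
to a critical node costs nothing. -/

namespace MaxPlus

/-! ### Surgery on walks -/

namespace Walk

variable {V : Type} {G H : Digraph V}

/-- Concatenation of walks. -/
def append : {i j k : V} → Walk G i j → Walk G j k → Walk G i k
  | _, _, _, nil _, q => q
  | _, _, _, cons h p, q => cons h (append p q)

/-- The sum of the real weights `u` of the edges of a walk, with multiplicity. -/
def realWeight (u : V → V → ℝ) {i j : V} (p : Walk G i j) : ℝ :=
  (p.edges.map fun e => u e.1 e.2).sum

@[simp] theorem length_nil (i : V) : (nil i : Walk G i i).length = 0 := rfl

@[simp] theorem length_cons {i j k : V} (h : G.Adj i j) (p : Walk G j k) :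
    (cons h p).length = p.length + 1 := rfl

@[simp] theorem support_nil (i : V) : (nil i : Walk G i i).support = [i] := rfl

@[simp] theorem support_cons {i j k : V} (h : G.Adj i j) (p : Walk G j k) :
    (cons h p).support = i :: p.support := rfl

@[simp] theorem edges_nil (i : V) : (nil i : Walk G i i).edges = [] := rfl

@[simp] theorem edges_cons {i j k : V} (h : G.Adj i j) (p : Walk G j k) :
    (cons h p).edges = (i, j) :: p.edges := rfl

@[simp] theorem nil_append {i j : V} (p : Walk G i j) : (nil i).append p = p := rfl

@[simp] theorem cons_append {i j k l : V} (h : G.Adj i j) (p : Walk G j k) (q : Walk G k l) :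
    (cons h p).append q = cons h (p.append q) := rfl

@[simp] theorem length_append {i j k : V} (p : Walk G i j) (q : Walk G j k) :
    (p.append q).length = p.length + q.length := by
  induction p with
  | nil => simp
  | cons h p ih => simp [ih]; omega

@[simp] theorem edges_append {i j k : V} (p : Walk G i j) (q : Walk G j k) :
    (p.append q).edges = p.edges ++ q.edges := by
  induction p with
  | nil => simp
  | cons h p ih => simp [ih]

theorem support_eq_cons {i j : V} (p : Walk G i j) : p.support = i :: p.support.tail := by
  cases p <;> rfl

theorem start_mem_support {i j : V} (p : Walk G i j) : i ∈ p.support := by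
  cases p <;> simp

theorem end_mem_support {i j : V} (p : Walk G i j) : j ∈ p.support := by
  induction p with
  | nil => simp
  | cons h p ih => simp [ih]

theorem support_append {i j k : V} (p : Walk G i j) (q : Walk G j k) :
    (p.append q).support = p.support ++ q.support.tail := by
  induction p with
  | nil i => simpa using q.support_eq_cons
  | cons h p ih => simp [ih]

theorem length_support {i j : V} (p : Walk G i j) : p.support.length = p.length + 1 := by
  induction p with
  | nil => simp
  | cons h p ih => simp [ih]

theorem length_edges {i j : V} (p : Walk G i j) : p.edges.length = p.length := by
  induction p with
  | nil => simp
  | cons h p ih => simp [ih]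

@[simp] theorem realWeight_nil (u : V → V → ℝ) (i : V) : (nil i : Walk G i i).realWeight u = 0 := by
  simp [realWeight]

@[simp] theorem realWeight_cons (u : V → V → ℝ) {i j k : V} (h : G.Adj i j) (p : Walk G j k) :
    (cons h p).realWeight u = u i j + p.realWeight u := by
  simp [realWeight]

@[simp] theorem realWeight_append (u : V → V → ℝ) {i j k : V} (p : Walk G i j)
    (q : Walk G j k) : (p.append q).realWeight u = p.realWeight u + q.realWeight u := by
  simp [realWeight]

theorem adj_of_mem_edges {i j : V} (p : Walk G i j) {e : V × V} (he : e ∈ p.edges) :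
    G.Adj e.1 e.2 := by
  induction p with
  | nil => simp at he
  | cons h p ih =>
    rcases List.mem_cons.1 he with rfl | he
    · exact h
    · exact ih he

/-- A walk whose edges lie in another digraph is a walk of that digraph. -/
theorem exists_transfer {i j : V} (p : Walk G i j) (h : ∀ e ∈ p.edges, H.Adj e.1 e.2) :
    ∃ q : Walk H i j, q.edges = p.edges ∧ q.length = p.length ∧ q.support = p.support := by
  induction p with
  | nil i => exact ⟨nil i, rfl, rfl, rfl⟩
  | @cons i k j hij p ih =>
    obtain ⟨q, h1, h2, h3⟩ := ih fun e he => h e (by simp [he])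
    exact ⟨cons (h (i, k) (by simp)) q, by simp [h1], by simp [h2], by simp [h3]⟩

theorem exists_map (hGH : G ≤ H) {i j : V} (p : Walk G i j) :
    ∃ q : Walk H i j, q.edges = p.edges ∧ q.length = p.length ∧ q.support = p.support :=
  p.exists_transfer fun _ he => hGH (p.adj_of_mem_edges he)

theorem realWeight_congr {u v : V → V → ℝ} {i j : V} (p : Walk G i j)
    (h : ∀ e ∈ p.edges, u e.1 e.2 = v e.1 e.2) : p.realWeight u = p.realWeight v := by
  unfold realWeight
  rw [List.map_congr_left h]

theorem realWeight_le {u v : V → V → ℝ} {i j : V} (p : Walk G i j)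
    (h : ∀ e ∈ p.edges, u e.1 e.2 ≤ v e.1 e.2) : p.realWeight u ≤ p.realWeight v :=
  List.sum_le_sum h

theorem realWeight_const (c : ℝ) {i j : V} (p : Walk G i j) :
    p.realWeight (fun _ _ => c) = p.length * c := by
  simp [realWeight, length_edges]

/-- Cutting a walk at its first visit of a node. -/
theorem exists_split [DecidableEq V] {i j w : V} (p : Walk G i j) (hw : w ∈ p.support) :
    ∃ (q : Walk G i w) (r : Walk G w j), p = q.append r ∧
      r.support.count w = p.support.count w := by
  induction p with
  | nil i =>
    obtain rfl : w = i := by simpa using hw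
    exact ⟨nil w, nil w, rfl, rfl⟩
  | @cons i k j h p ih =>
    by_cases hwi : w = i
    · subst hwi
      exact ⟨nil w, cons h p, rfl, rfl⟩
    · obtain ⟨q, r, rfl, hc⟩ := ih (by simpa [hwi] using hw)
      exact ⟨cons h q, r, rfl, by rw [hc]; simp [Ne.symm hwi]⟩

/-- Cutting off an initial segment of given length. -/
theorem exists_split_length {i j : V} (p : Walk G i j) {s : ℕ} (hs : s ≤ p.length) :
    ∃ (k : V) (q : Walk G i k) (r : Walk G k j), p = q.append r ∧ q.length = s := by
  induction p generalizing s with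
  | nil i => exact ⟨i, nil i, nil i, rfl, (Nat.le_zero.1 hs).symm⟩
  | @cons i k j h p ih =>
    cases s with
    | zero => exact ⟨i, nil i, cons h p, rfl, rfl⟩
    | succ s =>
      obtain ⟨k', q, r, rfl, hq⟩ := ih (s := s) (by simpa using hs)
      exact ⟨k', cons h q, r, rfl, by simp [hq]⟩

theorem exists_split_edge {i j : V} (p : Walk G i j) {e : V × V} (he : e ∈ p.edges) :
    ∃ (q : Walk G i e.1) (r : Walk G e.2 j) (h : G.Adj e.1 e.2), p = q.append (cons h r) := by
  induction p with
  | nil i => simp at he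
  | @cons i k j h p ih =>
    rcases List.mem_cons.1 he with rfl | he
    · exact ⟨nil i, p, h, rfl⟩
    · obtain ⟨q, r, h', rfl⟩ := ih he
      exact ⟨cons h q, r, h', rfl⟩

/-- A walk at whose start the start is visited again begins with a closed walk. -/
theorem exists_loop_of_count [DecidableEq V] {w j : V} (p : Walk G w j)
    (hp : 2 ≤ p.support.count w) :
    ∃ (c : Walk G w w) (r : Walk G w j), p = c.append r ∧ 0 < c.length ∧
      r.support.count w + 1 = p.support.count w := by
  cases p with
  | nil => simp at hp
  | cons h p =>
    have hw : w ∈ p.support := by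
      rw [support_cons, List.count_cons_self] at hp
      exact List.count_pos_iff.1 (by omega)
    obtain ⟨q, r, rfl, hc⟩ := p.exists_split hw
    exact ⟨cons h q, r, rfl, by simp, by simp [hc]⟩

theorem exists_loop_of_not_isPath {i j : V} (p : Walk G i j) (hp : ¬ p.IsPath) :
    ∃ (w : V) (q : Walk G i w) (c : Walk G w w) (r : Walk G w j),
      p = q.append (c.append r) ∧ 0 < c.length := by
  classical
  obtain ⟨w, hw⟩ : ∃ w, 2 ≤ p.support.count w := by
    by_contra! h
    exact hp (List.nodup_iff_count_le_one.2 fun a => by have := h a; omega)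
  obtain ⟨q, r, rfl, hc⟩ := p.exists_split (w := w) (List.count_pos_iff.1 (by omega))
  obtain ⟨c, r', rfl, h0, -⟩ := r.exists_loop_of_count (hc ▸ hw)
  exact ⟨w, q, c, r', rfl, h0⟩

/-- Closed subwalks have nonpositive weight, so cutting them out one after another never loses
weight. -/
theorem exists_isPath {u : V → V → ℝ}
    (hu : ∀ (k : V) (c : Walk G k k), c.realWeight u ≤ 0) {i j : V} (p : Walk G i j) :
    ∃ q : Walk G i j, q.IsPath ∧ p.realWeight u ≤ q.realWeight u ∧ q.length ≤ p.length := by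
  induction hn : p.length using Nat.strong_induction_on generalizing p with
  | _ n ih =>
    by_cases hp : p.IsPath
    · exact ⟨p, hp, le_rfl, hn.le⟩
    · obtain ⟨w, q, c, r, rfl, h0⟩ := p.exists_loop_of_not_isPath hp
      obtain ⟨s, hs, h1, h2⟩ := ih (q.append r).length (by simp at hn ⊢; omega) (q.append r) rfl
      refine ⟨s, hs, ?_, by simp at hn h2 ⊢; omega⟩
      have := hu _ c
      simp at h1 ⊢
      linarith

theorem exists_isPath_of_walk {i j : V} (p : Walk G i j) : ∃ q : Walk G i j, q.IsPath := by
  obtain ⟨q, hq, -⟩ := p.exists_isPath (u := fun _ _ => 0) (by simp [realWeight_const])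
  exact ⟨q, hq⟩

/-- An edge on a closed walk is an edge of a cycle. -/
theorem exists_isCycle_of_mem_edges {k : V} (c : Walk G k k) {e : V × V} (he : e ∈ c.edges) :
    ∃ p : Walk G e.1 e.1, p.IsCycle ∧ e ∈ p.edges := by
  obtain ⟨q, r, h, rfl⟩ := c.exists_split_edge he
  obtain ⟨s, hs⟩ := (r.append q).exists_isPath_of_walk
  exact ⟨cons h s, ⟨by simp, hs⟩, by simp⟩

/-- A closed walk that is not a cycle splits into two shorter closed walks. -/
theorem exists_split_of_not_isCycle {k : V} (c : Walk G k k) (h0 : 0 < c.length)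
    (hc : ¬ c.IsCycle) : ∃ (w : V) (c₁ : Walk G k k) (c₂ : Walk G w w), 0 < c₁.length ∧
      0 < c₂.length ∧ c.length = c₁.length + c₂.length ∧
      (∀ u : V → V → ℝ, c.realWeight u = c₁.realWeight u + c₂.realWeight u) := by
  cases c with
  | nil => simp at h0
  | cons h p =>
    obtain ⟨w, q, c, r, rfl, hc0⟩ := p.exists_loop_of_not_isPath fun hp => hc ⟨h0, hp⟩
    -- The first edge stays with the outer part, which is therefore nonempty and still based at `k`.
    exact ⟨w, cons h (q.append r), c, by simp, hc0, by simp; omega, fun u => by simp; ring⟩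

theorem realWeight_nonpos_of_isCycle {u : V → V → ℝ}
    (hu : ∀ (k : V) (c : Walk G k k), c.IsCycle → c.realWeight u ≤ 0) {k : V} (c : Walk G k k) :
    c.realWeight u ≤ 0 := by
  induction hn : c.length using Nat.strong_induction_on generalizing k c with
  | _ n ih =>
    by_cases hc : c.IsCycle
    · exact hu k c hc
    · rcases Nat.eq_zero_or_pos c.length with h0 | h0
      · cases c with
        | nil => simp
        | cons => simp at h0
      · obtain ⟨w, c₁, c₂, h1, h2, h3, h4⟩ := c.exists_split_of_not_isCycle h0 hc
        rw [h4]
        exact add_nonpos (ih _ (by omega) c₁ rfl) (ih _ (by omega) c₂ rfl)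

/-- Going `m` times around a closed walk. -/
theorem exists_repeat {k : V} (c : Walk G k k) (m : ℕ) :
    ∃ d : Walk G k k, d.length = m * c.length ∧
      (∀ u : V → V → ℝ, d.realWeight u = m * c.realWeight u) ∧
      (∀ e ∈ d.edges, e ∈ c.edges) := by
  induction m with
  | zero => exact ⟨nil k, by simp⟩
  | succ m ih =>
    obtain ⟨d, h1, h2, h3⟩ := ih
    refine ⟨c.append d, by simp [h1]; ring, fun u => by simp [h2]; ring, fun e he => ?_⟩
    rw [edges_append, List.mem_append] at he
    exact he.elim id (h3 e)

theorem IsPath.length_lt {n : ℕ} {G : Digraph (Fin n)} {i j : Fin n} {p : Walk G i j}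
    (hp : p.IsPath) : p.length < n := by
  have := List.Nodup.length_le_card hp
  rw [length_support, Fintype.card_fin] at this
  omega

theorem IsCycle.length_le {n : ℕ} {G : Digraph (Fin n)} {i : Fin n} {p : Walk G i i}
    (hp : p.IsCycle) : p.length ≤ n := by
  have := List.Nodup.length_le_card hp.2
  rw [List.length_tail, length_support, Fintype.card_fin] at this
  omega

end Walk

theorem SameScc.refl {V : Type} (G : Digraph V) (i : V) : SameScc G i i :=
  ⟨⟨Walk.nil i⟩, ⟨Walk.nil i⟩⟩

theorem SameScc.symm {V : Type} {G : Digraph V} {i j : V} (h : SameScc G i j) : SameScc G j i :=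
  ⟨h.2, h.1⟩

theorem SameScc.trans {V : Type} {G : Digraph V} {i j k : V} (h : SameScc G i j)
    (h' : SameScc G j k) : SameScc G i k := by
  obtain ⟨⟨p⟩, ⟨q⟩⟩ := h
  obtain ⟨⟨r⟩, ⟨s⟩⟩ := h'
  exact ⟨⟨p.append r⟩, ⟨s.append q⟩⟩

theorem length_le_circumference {n : ℕ} {G : Digraph (Fin n)} {i : Fin n} {p : Walk G i i}
    (hp : p.IsCycle) : p.length ≤ circumference G :=
  le_csSup ⟨n, by rintro _ ⟨i, p, hp, rfl⟩; exact hp.length_le⟩ ⟨i, p, hp, rfl⟩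

theorem length_le_cabDriverDiameter {n : ℕ} {G : Digraph (Fin n)} {i j : Fin n} {p : Walk G i j}
    (hp : p.IsPath) : p.length ≤ cabDriverDiameter G :=
  le_csSup ⟨n, by rintro _ ⟨i, j, p, hp, rfl⟩; exact hp.length_lt.le⟩ ⟨i, j, p, hp, rfl⟩

/-- A cycle without its first edge is a path. -/
theorem circumference_le_cabDriverDiameter {n : ℕ} (G : Digraph (Fin n)) :
    circumference G ≤ cabDriverDiameter G + 1 := by
  refine csSup_le' ?_
  rintro _ ⟨i, p, hp, rfl⟩
  cases p with
  | nil => simp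
  | cons h p => simpa using length_le_cabDriverDiameter (p := p) hp.2

/-! ### Cyclicity and closed walks -/

section Cyclicity

variable {n : ℕ} {G : Digraph (Fin n)} {i : Fin n}

theorem sccCyclicity_congr {j : Fin n} (h : SameScc G i j) :
    sccCyclicity G i = sccCyclicity G j := by
  unfold sccCyclicity
  congr 1
  ext d
  exact ⟨fun hd k p hk => hd k p (h.trans hk), fun hd k p hk => hd k p (h.symm.trans hk)⟩

/-- Closed walks at a single node determine the cyclicity: the length of a closed walk `c` elsewhere
in the component is the difference of the lengths of two closed walks at `i`, a round trip with and
without `c`. The closed walk of positive length bounds the common divisors, so that `sSup` is their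
maximum. -/
theorem sccCyclicity_eq_setGcd (hi : ∃ c : Walk G i i, 0 < c.length) :
    sccCyclicity G i = Nat.setGcd {l | ∃ c : Walk G i i, c.length = l} := by
  obtain ⟨c₀, hc₀⟩ := hi
  set s : Set ℕ := {l | ∃ c : Walk G i i, c.length = l} with hs
  have hpos : 0 < Nat.setGcd s :=
    Nat.pos_of_dvd_of_pos (Nat.setGcd_dvd_of_mem (⟨c₀, rfl⟩ : c₀.length ∈ s)) hc₀
  refine IsGreatest.csSup_eq ⟨?_, ?_⟩
  · rintro k c ⟨⟨p⟩, ⟨q⟩⟩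
    have h1 : Nat.setGcd s ∣ p.length + q.length :=
      Nat.setGcd_dvd_of_mem ⟨p.append q, by simp⟩
    have h2 : Nat.setGcd s ∣ (p.length + q.length) + c.length :=
      Nat.setGcd_dvd_of_mem ⟨(p.append c).append q, by simp; ring⟩
    exact (Nat.dvd_add_right h1).1 h2
  · intro d hd
    refine Nat.le_of_dvd hpos (Nat.dvd_setGcd_iff.2 ?_)
    rintro _ ⟨c, rfl⟩
    exact hd i c (SameScc.refl G i)

theorem sccCyclicity_pos (hi : ∃ c : Walk G i i, 0 < c.length) : 0 < sccCyclicity G i := by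
  obtain ⟨c, hc⟩ := hi
  rw [sccCyclicity_eq_setGcd ⟨c, hc⟩]
  exact Nat.pos_of_dvd_of_pos (Nat.setGcd_dvd_of_mem ⟨c, rfl⟩) hc

theorem sccCyclicity_dvd_length (hi : ∃ c : Walk G i i, 0 < c.length) (c : Walk G i i) :
    sccCyclicity G i ∣ c.length := by
  rw [sccCyclicity_eq_setGcd hi]
  exact Nat.setGcd_dvd_of_mem ⟨c, rfl⟩

theorem dvd_sccCyclicity (hi : ∃ c : Walk G i i, 0 < c.length) {d : ℕ}
    (hd : ∀ c : Walk G i i, d ∣ c.length) : d ∣ sccCyclicity G i := by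
  rw [sccCyclicity_eq_setGcd hi, Nat.dvd_setGcd_iff]
  rintro _ ⟨c, rfl⟩
  exact hd c

/-- All large multiples of the cyclicity are lengths of closed walks. -/
theorem exists_closedWalk_of_large (hi : ∃ c : Walk G i i, 0 < c.length) :
    ∃ N, ∀ t, sccCyclicity G i ∣ t → N ≤ t → ∃ c : Walk G i i, c.length = t := by
  rw [sccCyclicity_eq_setGcd hi]
  obtain ⟨N, hN⟩ := Nat.exists_mem_closure_of_ge {l | ∃ c : Walk G i i, c.length = l}
  refine ⟨N, fun t ht hNt => ?_⟩
  -- The lengths of closed walks at `i` already form an additive monoid, so the closure adds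
  -- nothing.
  suffices h : ∀ x ∈ AddSubmonoid.closure {l | ∃ c : Walk G i i, c.length = l},
      ∃ c : Walk G i i, c.length = x from h t (hN t hNt ht)
  intro x hx
  induction hx using AddSubmonoid.closure_induction with
  | mem x hx => exact hx
  | zero => exact ⟨Walk.nil i, rfl⟩
  | add x y _ _ hx hy =>
    obtain ⟨c, rfl⟩ := hx
    obtain ⟨d, rfl⟩ := hy
    exact ⟨c.append d, by simp⟩

theorem exists_closedWalk_of_explorationPenalty_le (hi : ∃ c : Walk G i i, 0 < c.length) {t : ℕ}
    (hd : sccCyclicity G i ∣ t) (ht : nodeExplorationPenalty G (sccCyclicity G i) i ≤ t) :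
    ∃ c : Walk G i i, c.length = t := by
  obtain ⟨N, hN⟩ := exists_closedWalk_of_large hi
  exact Nat.sInf_mem (s := {T | ∀ t, sccCyclicity G i ∣ t → T ≤ t →
    ∃ p : Walk G i i, p.length = t}) ⟨N, hN⟩ t hd ht

theorem roundedExplorationPenalty_spec (hi : ∃ c : Walk G i i, 0 < c.length) :
    sccCyclicity G i ∣ nodeRoundedExplorationPenalty G (sccCyclicity G i) i ∧
    ∀ t, sccCyclicity G i ∣ t → nodeRoundedExplorationPenalty G (sccCyclicity G i) i ≤ t →
      ∃ c : Walk G i i, c.length = t := by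
  obtain ⟨N, hN⟩ := exists_closedWalk_of_large hi
  refine Nat.sInf_mem (s := {T | sccCyclicity G i ∣ T ∧ ∀ t, sccCyclicity G i ∣ t → T ≤ t →
    ∃ p : Walk G i i, p.length = t}) ⟨sccCyclicity G i * N, dvd_mul_right _ _, fun t hd ht => ?_⟩
  exact hN t hd ((Nat.le_mul_of_pos_left N (sccCyclicity_pos hi)).trans ht)

theorem exists_cycle_of_closedWalk {k : Fin n} (c : Walk G k k) (hc : 0 < c.length) :
    ∃ (w : Fin n) (p : Walk G w w), p.IsCycle ∧ SameScc G k w := by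
  cases c with
  | nil => simp at hc
  | @cons _ m _ h p =>
    obtain ⟨q, hq, -⟩ := (Walk.cons h p).exists_isCycle_of_mem_edges (e := (k, m)) (by simp)
    exact ⟨k, q, hq, SameScc.refl G k⟩

/-- A cycle of minimal length in the component of a node. -/
theorem exists_girth_cycle (hi : ∃ c : Walk G i i, 0 < c.length) :
    ∃ (w : Fin n) (p : Walk G w w), p.IsCycle ∧ SameScc G i w ∧ p.length = sccGirth G i := by
  obtain ⟨c, hc⟩ := hi
  obtain ⟨w, p, hp, hw⟩ := exists_cycle_of_closedWalk c hc
  obtain ⟨k, q, hk, hq, hl⟩ := Nat.sInf_mem (s := {L | ∃ (k : Fin n) (p : Walk G k k),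
    SameScc G i k ∧ p.IsCycle ∧ p.length = L}) ⟨_, w, p, hw, hp, rfl⟩
  exact ⟨k, q, hq, hk, hl⟩

end Cyclicity

/-- Among `n` elements of `ZMod n` some have sum zero. -/
theorem exists_sublist_sum_eq_zero {α : Type*} {m : ℕ} [NeZero m] (δ : α → ZMod m) (l : List α)
    (hl : m ≤ l.length) : ∃ l' : List α, l'.Sublist l ∧ l' ≠ [] ∧ (l'.map δ).sum = 0 := by
  -- Two of the `m + 1` prefix sums agree; the segment between them has sum zero.
  obtain ⟨a, b, hab, h⟩ : ∃ a b : Fin (m + 1), a < b ∧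
      ((l.take a).map δ).sum = ((l.take b).map δ).sum := by
    obtain ⟨a, b, hne, h⟩ := Fintype.exists_ne_map_eq_of_card_lt
      (fun a : Fin (m + 1) => ((l.take a).map δ).sum) (by simp [ZMod.card])
    rcases lt_or_gt_of_ne hne with hlt | hlt
    · exact ⟨a, b, hlt, h⟩
    · exact ⟨b, a, hlt, h.symm⟩
  have hb := b.isLt
  have hab' : (a : ℕ) < b := hab
  refine ⟨(l.take b).drop a, (List.drop_sublist _ _).trans (List.take_sublist _ _), ?_, ?_⟩
  · apply List.ne_nil_of_length_pos
    rw [List.length_drop, List.length_take]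
    omega
  · have h1 : l.take b = l.take a ++ (l.take b).drop a := by
      conv_lhs => rw [← List.take_append_drop a (l.take b)]
      rw [List.take_take, min_eq_left hab'.le]
    rw [h1, List.map_append, List.sum_append] at h
    simpa using h.symm

theorem exists_sublist_dvd_sum {m : ℕ} (hm : 0 < m) (l : List ℕ) (hl : m ≤ l.length) :
    ∃ l' : List ℕ, l'.Sublist l ∧ l' ≠ [] ∧ m ∣ l'.sum := by
  have : NeZero m := ⟨hm.ne'⟩
  obtain ⟨l', h1, h2, h3⟩ := exists_sublist_sum_eq_zero (fun a : ℕ => (a : ZMod m)) l hl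
  refine ⟨l', h1, h2, ?_⟩
  rw [← ZMod.natCast_eq_zero_iff, Nat.cast_list_sum]
  exact h3

/-! ### Removing closed walks -/

/-- `L` lists the lengths of closed walks of which any selection can be removed from `p` without
making it lighter. -/
def HasLoops {V : Type} {D : Digraph V} (u : V → V → ℝ) {i j : V} (p : Walk D i j)
    (L : List ℕ) : Prop :=
  (∀ l ∈ L, 0 < l) ∧ ∀ L' : List ℕ, L'.Sublist L → ∃ q : Walk D i j,
    q.length + L'.sum = p.length ∧ p.realWeight u ≤ q.realWeight u

section Loops

variable {V : Type} {D : Digraph V} {u : V → V → ℝ}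

theorem HasLoops.nil {i j : V} (p : Walk D i j) : HasLoops u p [] :=
  ⟨by simp, fun L' hL' => ⟨p, by simp [List.eq_nil_of_sublist_nil hL'], le_rfl⟩⟩

theorem HasLoops.closed (hu : ∀ (k : V) (c : Walk D k k), c.realWeight u ≤ 0) {k : V}
    (c : Walk D k k) (hc : 0 < c.length) : HasLoops u c [c.length] := by
  refine ⟨by simpa using hc, fun L' hL' => ?_⟩
  rcases List.sublist_singleton.1 hL' with rfl | rfl
  · exact ⟨c, by simp, le_rfl⟩
  · exact ⟨Walk.nil k, by simp, by simpa using hu k c⟩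

theorem HasLoops.append {i j k : V} {p : Walk D i j} {q : Walk D j k} {L M : List ℕ}
    (hp : HasLoops u p L) (hq : HasLoops u q M) : HasLoops u (p.append q) (L ++ M) := by
  refine ⟨fun l hl => (List.mem_append.1 hl).elim (hp.1 l) (hq.1 l), fun L' hL' => ?_⟩
  obtain ⟨L₁, L₂, rfl, h₁, h₂⟩ := List.sublist_append_iff.1 hL'
  obtain ⟨p', hp1, hp2⟩ := hp.2 _ h₁
  obtain ⟨q', hq1, hq2⟩ := hq.2 _ h₂
  exact ⟨p'.append q', by simp; omega, by simp; linarith⟩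

/-- The pieces between consecutive visits of `w` are the removable closed walks, one fewer than the
visits. -/
theorem exists_hasLoops_of_count_start [DecidableEq V]
    (hu : ∀ (k : V) (c : Walk D k k), c.realWeight u ≤ 0) {w j : V} (p : Walk D w j) :
    ∃ L, HasLoops u p L ∧ L.length + 1 = p.support.count w := by
  induction hm : p.support.count w generalizing p with
  | zero => exact absurd (List.count_pos_iff.2 p.start_mem_support) (by omega)
  | succ m ih =>
    rcases Nat.eq_zero_or_pos m with rfl | h0
    · exact ⟨[], HasLoops.nil p, rfl⟩
    · obtain ⟨c, r, rfl, hc, hr⟩ := p.exists_loop_of_count (by omega)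
      obtain ⟨L, hL, hl⟩ := ih r (by omega)
      exact ⟨[c.length] ++ L, (HasLoops.closed hu c hc).append hL, by simp [hl]⟩

theorem exists_hasLoops_of_count [DecidableEq V]
    (hu : ∀ (k : V) (c : Walk D k k), c.realWeight u ≤ 0) {i j w : V} (p : Walk D i j)
    (hw : w ∈ p.support) : ∃ L, HasLoops u p L ∧ L.length + 1 = p.support.count w := by
  obtain ⟨q, r, rfl, hc⟩ := p.exists_split hw
  obtain ⟨L, hL, hl⟩ := exists_hasLoops_of_count_start hu r
  exact ⟨[] ++ L, (HasLoops.nil q).append hL, by rw [← hc, ← hl]; simp⟩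

theorem exists_hasLoops_of_not_isPath
    (hu : ∀ (k : V) (c : Walk D k k), c.realWeight u ≤ 0) {i j : V} (p : Walk D i j)
    (hp : ¬ p.IsPath) : ∃ l, HasLoops u p [l] := by
  obtain ⟨w, q, c, r, rfl, hc⟩ := p.exists_loop_of_not_isPath hp
  exact ⟨c.length, (HasLoops.nil q).append ((HasLoops.closed hu c hc).append (HasLoops.nil r))⟩

/-- A long walk has many disjoint closed subwalks. -/
theorem exists_hasLoops_of_length {n : ℕ} {D : Digraph (Fin n)} {u : Fin n → Fin n → ℝ}
    (hu : ∀ (k : Fin n) (c : Walk D k k), c.realWeight u ≤ 0) {i j : Fin n} (p : Walk D i j) :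
    ∃ L, HasLoops u p L ∧
      p.length ≤ L.length * (cabDriverDiameter D + 1) + cabDriverDiameter D := by
  induction hm : p.length using Nat.strong_induction_on generalizing i p with
  | _ m ih =>
    rcases Nat.lt_or_ge m (cabDriverDiameter D + 1) with h | h
    · exact ⟨[], HasLoops.nil p, by simp; omega⟩
    -- An initial block of `cabDriverDiameter D + 1` edges is too long to be a path, so it contains
    -- a closed walk.
    · obtain ⟨k, q, r, rfl, hq⟩ := p.exists_split_length (hm ▸ h)
      have hr : r.length + (cabDriverDiameter D + 1) = m := by simp at hm; omega
      obtain ⟨L, hL, hl⟩ := ih r.length (by omega) r rfl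
      obtain ⟨l, hl'⟩ := exists_hasLoops_of_not_isPath hu q
        fun hp => by have := length_le_cabDriverDiameter hp; omega
      refine ⟨[l] ++ L, hl'.append hL, ?_⟩
      simp only [List.length_append, List.length_singleton]
      linarith

end Loops

/-- There is a walk from `i` to `j` through `z` of length `l` and weight at least `c`. -/
def WalkThrough {V : Type} (D : Digraph V) (u : V → V → ℝ) (i j : V) (c : ℝ) (z : V)
    (l : ℕ) : Prop :=
  ∃ (p : Walk D i z) (q : Walk D z j), p.length + q.length = l ∧
    c ≤ p.realWeight u + q.realWeight u

section WalkThrough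

variable {V : Type} {D : Digraph V} {u : V → V → ℝ} {i j : V} {c : ℝ}

/-- Closed subwalks are removed separately before and after `z`, so `z` is still visited. Among `m`
of them a nonempty selection has total length divisible by `m`. -/
theorem exists_shorter_walkThrough {z : V} {p : Walk D i z} {q : Walk D z j}
    (hc : c ≤ p.realWeight u + q.realWeight u) {L M : List ℕ} (hp : HasLoops u p L)
    (hq : HasLoops u q M) {m : ℕ} (hm : 0 < m) (hLM : m ≤ L.length + M.length) :
    ∃ l, WalkThrough D u i j c z l ∧ l < p.length + q.length ∧
      l ≡ p.length + q.length [MOD m] := by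
  obtain ⟨l', h1, h2, h3⟩ := exists_sublist_dvd_sum hm (L ++ M) (by simpa using hLM)
  obtain ⟨L', M', rfl, hL', hM'⟩ := List.sublist_append_iff.1 h1
  obtain ⟨p', hp1, hp2⟩ := hp.2 _ hL'
  obtain ⟨q', hq1, hq2⟩ := hq.2 _ hM'
  have hpos : 0 < (L' ++ M').sum := by
    obtain ⟨x, hx⟩ := List.exists_mem_of_ne_nil _ h2
    have hx0 : 0 < x := (List.mem_append.1 hx).elim (fun h => hp.1 x (hL'.subset h))
      (fun h => hq.1 x (hM'.subset h))
    exact hx0.trans_le (List.le_sum_of_mem hx)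
  rw [List.sum_append] at hpos h3
  refine ⟨p'.length + q'.length, ⟨p', q', rfl, by linarith⟩, by omega, ?_⟩
  rw [Nat.modEq_iff_dvd' (by omega)]
  convert h3 using 1
  omega

end WalkThrough

/-! ### Length bounds for shortest walks in a class -/

section Bounds

variable {n : ℕ} {D : Digraph (Fin n)} {u : Fin n → Fin n → ℝ} {i j : Fin n} {c : ℝ}

theorem exists_walkThrough_le_cabDriverDiameter
    (hu : ∀ (k : Fin n) (c : Walk D k k), c.realWeight u ≤ 0) {m : ℕ} (hm : 0 < m) {z : Fin n}
    {l : ℕ} (h : WalkThrough D u i j c z l) :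
    ∃ l', WalkThrough D u i j c z l' ∧ l' ≡ l [MOD m] ∧
      l' + 1 ≤ (m + 1) * cabDriverDiameter D + m := by
  induction l using Nat.strong_induction_on with
  | _ l ih =>
    by_cases hl : l + 1 ≤ (m + 1) * cabDriverDiameter D + m
    · exact ⟨l, h, rfl, hl⟩
    · obtain ⟨p, q, rfl, hc⟩ := h
      obtain ⟨L, hL, hpL⟩ := exists_hasLoops_of_length hu p
      obtain ⟨M, hM, hqM⟩ := exists_hasLoops_of_length hu q
      obtain ⟨l', h1, h2, h3⟩ := exists_shorter_walkThrough hc hL hM hm (by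
        -- With at most `m - 1` closed subwalks in the two halves together, the length is at most
        -- `(m - 1)(cd + 1) + 2 cd = (m + 1) cd + m - 1`, where `cd` is `cabDriverDiameter D`.
        by_contra! hlt
        have : (L.length + M.length) * (cabDriverDiameter D + 1) ≤
            (m - 1) * (cabDriverDiameter D + 1) := Nat.mul_le_mul_right _ (by omega)
        obtain ⟨m, rfl⟩ : ∃ k, m = k + 1 := ⟨m - 1, by omega⟩
        simp only [Nat.add_sub_cancel] at this
        apply hl
        linarith)
      obtain ⟨l'', h4, h5, h6⟩ := ih l' h2 h1
      exact ⟨l'', h4, h5.trans h3, h6⟩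

/-- If no node of `Z` on a walk admits a shorter walk through it whose length is in the same class
modulo `m`, then nodes of `Z` are visited at most `m` times, other nodes at most `m + 1` times. -/
theorem length_le_of_minimal
    (hu : ∀ (k : Fin n) (c : Walk D k k), c.realWeight u ≤ 0) {m : ℕ} (hm : 0 < m) {z : Fin n}
    (p : Walk D i z) (q : Walk D z j) (hc : c ≤ p.realWeight u + q.realWeight u)
    (Z : Finset (Fin n)) (hz : z ∈ Z)
    (hmin : ∀ w ∈ Z, w ∈ (p.append q).support → ∀ l < p.length + q.length,
      l ≡ p.length + q.length [MOD m] → ¬ WalkThrough D u i j c w l) :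
    p.length + q.length + 1 + Z.card ≤ m * n + n := by
  set s := (p.append q).support with hs
  have key (w : Fin n) : s.count w + (if w ∈ Z then 1 else 0) ≤ m + 1 := by
    split_ifs with hw
    -- A node of `Z` can replace `z` as marked node. Splitting at its first visit puts all its
    -- closed subwalks in the second part, so `m + 1` visits give `m` of them.
    · by_contra! hlt
      have hws : w ∈ s := List.count_pos_iff.1 (by omega)
      obtain ⟨p', q', hpq, hcount⟩ := (p.append q).exists_split hws
      obtain ⟨L, hL, hl⟩ := exists_hasLoops_of_count_start hu q'
      have hlen : p'.length + q'.length = p.length + q.length := by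
        have := congrArg Walk.length hpq; simpa using this.symm
      have hwt : c ≤ p'.realWeight u + q'.realWeight u := by
        have := congrArg (Walk.realWeight u) hpq
        simp only [Walk.realWeight_append] at this
        linarith
      obtain ⟨l, h1, h2, h3⟩ := exists_shorter_walkThrough hwt (HasLoops.nil p') hL hm
        (by rw [← hs] at hcount; simp; omega)
      rw [hlen] at h2 h3
      exact hmin w hw hws l h2 h3 h1
    -- For other nodes the mark stays at `z`. Each half may lose one closed subwalk, so `m + 2`
    -- visits are needed for `m` of them.
    · by_contra! hlt
      have hcount : s.count w = p.support.count w + q.support.tail.count w := by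
        rw [hs, Walk.support_append, List.count_append]
      have hwz : w ≠ z := fun h => hw (h ▸ hz)
      have hq : q.support.count w = q.support.tail.count w := by
        conv_lhs => rw [q.support_eq_cons]
        exact List.count_cons_of_ne hwz.symm
      have hL : ∃ L, HasLoops u p L ∧ p.support.count w ≤ L.length + 1 := by
        by_cases h : w ∈ p.support
        · obtain ⟨L, hL, hl⟩ := exists_hasLoops_of_count hu p h
          exact ⟨L, hL, hl.ge⟩
        · exact ⟨[], HasLoops.nil p, by simp [List.count_eq_zero.2 h]⟩
      have hM : ∃ L, HasLoops u q L ∧ q.support.count w ≤ L.length + 1 := by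
        by_cases h : w ∈ q.support
        · obtain ⟨L, hL, hl⟩ := exists_hasLoops_of_count hu q h
          exact ⟨L, hL, hl.ge⟩
        · exact ⟨[], HasLoops.nil q, by simp [List.count_eq_zero.2 h]⟩
      obtain ⟨L, hL, hl⟩ := hL
      obtain ⟨M, hM, hl'⟩ := hM
      obtain ⟨l, h1, h2, h3⟩ := exists_shorter_walkThrough hc hL hM hm (by omega)
      exact hmin z hz (by rw [hs, Walk.support_append]; simp [p.end_mem_support]) l h2 h3 h1
  have hsum := Finset.sum_le_sum fun w (_ : w ∈ Finset.univ) => key w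
  rw [Finset.sum_add_distrib] at hsum
  have h1 : ∑ w : Fin n, s.count w = p.length + q.length + 1 := by
    have := Multiset.sum_count_eq_card (s := Finset.univ) (m := (s : Multiset (Fin n)))
      (fun a _ => Finset.mem_univ a)
    simp only [Multiset.coe_count, Multiset.coe_card] at this
    rw [this, hs, Walk.length_support, Walk.length_append]
  rw [h1] at hsum
  simp at hsum
  linarith

end Bounds

theorem Walk.mem_support_append {V : Type} {G : Digraph V} {i j k w : V} (p : Walk G i j)
    (q : Walk G j k) : w ∈ (p.append q).support ↔ w ∈ p.support ∨ w ∈ q.support := by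
  rw [Walk.support_append, List.mem_append]
  refine ⟨fun h => h.imp_right List.mem_of_mem_tail, fun h => ?_⟩
  rcases h with h | h
  · exact Or.inl h
  · rw [q.support_eq_cons] at h
    rcases List.mem_cons.1 h with rfl | h
    · exact Or.inl p.end_mem_support
    · exact Or.inr h

theorem le_of_modEq_of_lt_add {a t m : ℕ} (h : a ≡ t [MOD m]) (hlt : a < t + m) : a ≤ t := by
  by_contra! hta
  have h1 := (Nat.modEq_iff_dvd' hta.le).1 h.symm
  have h2 := Nat.le_of_dvd (by omega) h1
  omega

/-- The weights `u` make no closed walk of `D` positive and vanish on the edges of the completely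
reducible subgraph `H`. -/
structure IsNormalized {V : Type} (D H : Digraph V) (u : V → V → ℝ) : Prop where
  le : H ≤ D
  closed_nonpos : ∀ (k : V) (c : Walk D k k), c.realWeight u ≤ 0
  eq_zero : ∀ a b, H.Adj a b → u a b = 0
  sameScc : ∀ a b, H.Adj a b → SameScc H a b

theorem exists_closedWalk_of_isNode {V : Type} {H : Digraph V}
    (h : ∀ a b, H.Adj a b → SameScc H a b) {z : V} (hz : IsNode H z) :
    ∃ c : Walk H z z, 0 < c.length := by
  obtain ⟨w, hw | hw⟩ := hz
  · obtain ⟨q⟩ := (h _ _ hw).2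
    exact ⟨Walk.cons hw q, by simp⟩
  · obtain ⟨q⟩ := (h _ _ hw).2
    exact ⟨q.append (Walk.cons hw (Walk.nil z)), by simp⟩

theorem isNode_of_closedWalk {V : Type} {H : Digraph V} {z : V} (c : Walk H z z)
    (hc : 0 < c.length) : IsNode H z := by
  cases c with
  | nil => simp at hc
  | cons h p => exact ⟨_, Or.inl h⟩

theorem IsNode.of_sameScc {V : Type} {H : Digraph V} {z w : V} (hz : IsNode H z)
    (h : SameScc H z w) : IsNode H w := by
  obtain ⟨⟨p⟩, -⟩ := h.symm
  cases p with
  | nil => exact hz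
  | cons h p => exact ⟨_, Or.inl h⟩

theorem sccCyclicity_le_maxCyclicity {n : ℕ} {G : Digraph (Fin n)} {z : Fin n} (hz : IsNode G z) :
    sccCyclicity G z ≤ maxCyclicity G := by
  classical
  unfold maxCyclicity
  exact Finset.le_sup (f := sccCyclicity G) (by simpa using hz)

theorem sccGirth_le_maxGirth {n : ℕ} {G : Digraph (Fin n)} {z : Fin n} (hz : IsNode G z) :
    sccGirth G z ≤ maxGirth G := by
  classical
  unfold maxGirth
  exact Finset.le_sup (f := sccGirth G) (by simpa using hz)

theorem nodeExplorationPenalty_le {n : ℕ} {G : Digraph (Fin n)} {z : Fin n} (hz : IsNode G z) :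
    nodeExplorationPenalty G (sccCyclicity G z) z ≤ explorationPenalty G := by
  classical
  unfold explorationPenalty
  exact Finset.le_sup (f := fun i => nodeExplorationPenalty G (sccCyclicity G i) i)
    (by simpa using hz)

theorem nodeRoundedExplorationPenalty_le {n : ℕ} {G : Digraph (Fin n)} {z : Fin n} (hz : IsNode G z) :
    nodeRoundedExplorationPenalty G (sccCyclicity G z) z ≤ roundedExplorationPenalty G := by
  classical
  unfold roundedExplorationPenalty
  exact Finset.le_sup (f := fun i => nodeRoundedExplorationPenalty G (sccCyclicity G i) i)
    (by simpa using hz)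

/-! ### Adjusting the length of walks through the subgraph `H` -/

namespace IsNormalized

section General

variable {V : Type} {D H : Digraph V} {u : V → V → ℝ} {i j : V} {c : ℝ}

theorem exists_lift (hN : IsNormalized D H u) {a b : V} (p : Walk H a b) :
    ∃ q : Walk D a b, q.length = p.length ∧ q.realWeight u = 0 := by
  obtain ⟨q, h1, h2, -⟩ := p.exists_map hN.le
  refine ⟨q, h2, ?_⟩
  rw [q.realWeight_congr (v := fun _ _ => 0), Walk.realWeight_const, mul_zero]
  intro e he
  exact hN.eq_zero _ _ (p.adj_of_mem_edges (h1 ▸ he))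

theorem insert (hN : IsNormalized D H u) {z : V} {l : ℕ} (h : WalkThrough D u i j c z l)
    (d : Walk H z z) : WalkThrough D u i j c z (l + d.length) := by
  obtain ⟨p, q, rfl, hc⟩ := h
  obtain ⟨e, h1, h2⟩ := hN.exists_lift d
  exact ⟨p.append e, q, by simp; omega, by simp; linarith⟩

/-- Going around a closed walk of length `m` fills the gap between lengths in the same class. -/
theorem extend (hN : IsNormalized D H u) {z : V} {l t m : ℕ} (h : WalkThrough D u i j c z l)
    (d : Walk H z z) (hd : d.length = m) (hlt : l ≡ t [MOD m]) (hle : l ≤ t) :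
    WalkThrough D u i j c z t := by
  obtain ⟨k, hk⟩ := (Nat.modEq_iff_dvd' hle).1 hlt
  obtain ⟨e, h1, -⟩ := d.exists_repeat k
  have := hN.insert h e
  rwa [h1, hd, mul_comm, ← hk, Nat.add_sub_cancel' hle] at this

end General

variable {n : ℕ} {D H : Digraph (Fin n)} {u : Fin n → Fin n → ℝ} {i j : Fin n} {c : ℝ}

/-- A round trip from `z` through `w` inside `H` is free, and its length is a multiple of the
cyclicity. -/
theorem move (hN : IsNormalized D H u) {z w : Fin n} {l : ℕ} (h : WalkThrough D u i j c z l)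
    (hz : IsNode H z) (hzw : SameScc H z w) :
    ∃ l', WalkThrough D u i j c w l' ∧ l' ≡ l [MOD sccCyclicity H z] := by
  obtain ⟨⟨a⟩, ⟨b⟩⟩ := hzw
  obtain ⟨p, q, rfl, hc⟩ := h
  obtain ⟨a', h1, h2⟩ := hN.exists_lift a
  obtain ⟨b', h3, h4⟩ := hN.exists_lift b
  refine ⟨_, ⟨p.append a', b'.append q, rfl, by simp; linarith⟩, ?_⟩
  have hdvd := sccCyclicity_dvd_length (exists_closedWalk_of_isNode hN.sameScc hz) (a.append b)
  rw [Walk.length_append] at hdvd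
  have h5 : (p.append a').length + (b'.append q).length =
      p.length + q.length + (a.length + b.length) := by simp; omega
  rw [h5]
  exact (Nat.modEq_iff_dvd' (by omega)).2 (by simpa using hdvd) |>.symm

theorem exists_closedWalk_modEq (hN : IsNormalized D H u) {z : Fin n} (hz : IsNode H z)
    {l t m : ℕ} (hl : l ≡ t [MOD sccCyclicity H z]) (hm : 0 < m) (hdvd : sccCyclicity H z ∣ m) :
    ∃ d : Walk H z z, l + d.length ≡ t [MOD m] := by
  obtain ⟨N, hN⟩ := exists_closedWalk_of_large (exists_closedWalk_of_isNode hN.sameScc hz)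
  have hle : l ≤ l * m := Nat.le_mul_of_pos_right l hm
  -- The length is chosen so that `l + d.length = t + m * (l + N)`, which is `t` modulo `m`; the
  -- term `m * N` makes `d` long enough to exist.
  obtain ⟨d, hd⟩ := hN (t + (l * m - l) + m * N) (by
    have h1 : l + (t + (l * m - l) + m * N) ≡ l + 0 [MOD sccCyclicity H z] := by
      have h2 : l + (t + (l * m - l) + m * N) = t + m * (l + N) := by
        rw [mul_add, mul_comm m l]; omega
      rw [h2]
      exact (Nat.ModEq.add hl.symm ((Nat.modEq_zero_iff_dvd).2 (hdvd.mul_right _)))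
    exact (Nat.modEq_zero_iff_dvd).1 (Nat.ModEq.add_left_cancel' l h1))
    (le_add_left (Nat.le_mul_of_pos_left N hm))
  refine ⟨d, ?_⟩
  have h2 : l + d.length = t + m * (l + N) := by
    rw [hd, mul_add, mul_comm m l]; omega
  rw [h2]
  simp [Nat.ModEq]

theorem exists_modEq (hN : IsNormalized D H u) {z : Fin n} (hz : IsNode H z) {l t m : ℕ}
    (h : WalkThrough D u i j c z l) (hl : l ≡ t [MOD sccCyclicity H z]) (hm : 0 < m)
    (hdvd : sccCyclicity H z ∣ m) :
    ∃ l', WalkThrough D u i j c z l' ∧ l' ≡ t [MOD m] := by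
  obtain ⟨d, hd⟩ := hN.exists_closedWalk_modEq hz hl hm hdvd
  exact ⟨_, hN.insert h d, hd⟩

/-- After shortening modulo the cyclicity, the missing length is a multiple of it and at least the
penalty of `z`, so one closed walk at `z` fills it. -/
theorem walkThrough_of_explorationPenalty (hN : IsNormalized D H u) {z : Fin n} (hz : IsNode H z)
    {l t : ℕ} (h : WalkThrough D u i j c z l) (hl : l ≡ t [MOD sccCyclicity H z])
    (ht : (sccCyclicity H z + 1) * cabDriverDiameter D + sccCyclicity H z +
      nodeExplorationPenalty H (sccCyclicity H z) z ≤ t + 1) :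
    WalkThrough D u i j c z t := by
  have hc := exists_closedWalk_of_isNode hN.sameScc hz
  obtain ⟨l', h1, h2, h3⟩ := exists_walkThrough_le_cabDriverDiameter hN.closed_nonpos
    (sccCyclicity_pos hc) h
  obtain ⟨d, hd⟩ := exists_closedWalk_of_explorationPenalty_le hc (t := t - l')
    ((Nat.modEq_iff_dvd' (by omega)).1 (h2.trans hl)) (by omega)
  have := hN.insert h1 d
  rwa [hd, Nat.add_sub_cancel' (by omega)] at this

/-- Moving a walk to a shortest cycle of the component, with length in the prescribed class. -/
theorem exists_walkThrough_girth (hN : IsNormalized D H u) {z : Fin n} (hz : IsNode H z)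
    {l t : ℕ} (h : WalkThrough D u i j c z l) (hl : l ≡ t [MOD sccCyclicity H z]) :
    ∃ (w : Fin n) (p : Walk H w w) (l' : ℕ), p.IsCycle ∧ p.length = sccGirth H z ∧
      WalkThrough D u i j c w l' ∧ l' ≡ t [MOD sccGirth H z] := by
  have hc := exists_closedWalk_of_isNode hN.sameScc hz
  obtain ⟨w, p, hp, hzw, hpl⟩ := exists_girth_cycle hc
  obtain ⟨l₁, h1, h2⟩ := hN.move h hz hzw
  have hw := hz.of_sameScc hzw
  rw [sccCyclicity_congr hzw] at h2 hl
  obtain ⟨l₂, h3, h4⟩ := hN.exists_modEq hw h1 (h2.trans hl) hp.1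
    (sccCyclicity_dvd_length (exists_closedWalk_of_isNode hN.sameScc hw) p)
  exact ⟨w, p, l₂, hp, hpl, h3, hpl ▸ h4⟩

theorem walkThrough_of_girth_cabDriverDiameter (hN : IsNormalized D H u) {z : Fin n}
    (hz : IsNode H z) {l t : ℕ} (h : WalkThrough D u i j c z l)
    (hl : l ≡ t [MOD sccCyclicity H z])
    (ht : (sccGirth H z + 1) * cabDriverDiameter D + sccGirth H z ≤ t + 1) :
    ∃ w, IsNode H w ∧ WalkThrough D u i j c w t := by
  obtain ⟨w, p, l', hp, hpl, h1, h2⟩ := hN.exists_walkThrough_girth hz h hl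
  obtain ⟨l'', h3, h4, h5⟩ := exists_walkThrough_le_cabDriverDiameter hN.closed_nonpos
    (hpl ▸ hp.1) h1
  exact ⟨w, isNode_of_closedWalk p hp.1, hN.extend h3 p hpl (h4.trans h2) (by omega)⟩

/-- A walk through a node of a shortest cycle may use any node of that cycle as its mark. A shortest
walk of the class therefore visits each of these `g` nodes at most `g` times, so its length is at
most `g n + n - 1 - g`. Being congruent to `t` modulo `g`, it only has to be less than `t + g`. -/
theorem walkThrough_of_girth (hN : IsNormalized D H u) {z : Fin n} (hz : IsNode H z)
    {l t : ℕ} (h : WalkThrough D u i j c z l) (hl : l ≡ t [MOD sccCyclicity H z])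
    (ht : sccGirth H z * n + n ≤ t + 2 * sccGirth H z) :
    ∃ w, IsNode H w ∧ WalkThrough D u i j c w t := by
  classical
  obtain ⟨w, p, l', hp, hpl, h1, h2⟩ := hN.exists_walkThrough_girth hz h hl
  set g := sccGirth H z with hg
  have hg0 : 0 < g := hpl ▸ hp.1
  set Z : Finset (Fin n) := p.support.tail.toFinset with hZ
  have hZcard : Z.card = g := by
    rw [hZ, List.toFinset_card_of_nodup hp.2, List.length_tail, Walk.length_support, hpl]
    rfl
  have hwZ : w ∈ Z := by
    cases p with
    | nil => exact absurd hp.1 (Nat.lt_irrefl 0)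
    | cons h p => simpa [hZ] using p.end_mem_support
  have hex : ∃ l, ∃ w ∈ Z, WalkThrough D u i j c w l ∧ l ≡ t [MOD g] := ⟨l', w, hwZ, h1, h2⟩
  obtain ⟨v, hv, ⟨a, b, hab, hc⟩, h4⟩ := Nat.find_spec hex
  have hmin := length_le_of_minimal hN.closed_nonpos hg0 a b hc Z hv (by
    intro x hx _ l hlt hmod hwt
    rw [hab] at hlt hmod
    exact Nat.find_min hex hlt ⟨x, hx, hwt, hmod.trans h4⟩)
  rw [hab, hZcard] at hmin
  have hvs : v ∈ p.support := List.mem_of_mem_tail (List.mem_toFinset.1 hv)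
  -- The cycle is rotated so as to start at `v`.
  obtain ⟨q, r, hqr, -⟩ := p.exists_split hvs
  have hlen : (r.append q).length = g := by
    have := congrArg Walk.length hqr
    simp at this ⊢
    omega
  refine ⟨v, isNode_of_closedWalk (r.append q) (hlen ▸ hg0),
    hN.extend ⟨a, b, hab, hc⟩ (r.append q) hlen h4 (le_of_modEq_of_lt_add h4 ?_)⟩
  omega

/-- Among all critical nodes with a walk in the right class, one of least cyclicity `γ` is taken,
and then a shortest such walk. The set `Z` consists of the critical nodes of cyclicity at most `γ`,
and the double minimality makes the visit count apply to all of them. -/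
theorem walkThrough_of_roundedExplorationPenalty (hN : IsNormalized D H u) {z : Fin n}
    (hz : IsNode H z) {l t : ℕ} (h : WalkThrough D u i j c z l)
    (hl : l ≡ t [MOD sccCyclicity H z])
    (ht : maxCyclicity H * n + n + roundedExplorationPenalty H ≤
      t + maxCyclicity H + nodeCount H) :
    ∃ w, IsNode H w ∧ WalkThrough D u i j c w t := by
  classical
  have hex : ∃ γ z l, IsNode H z ∧ sccCyclicity H z = γ ∧ WalkThrough D u i j c z l ∧
      l ≡ t [MOD γ] := ⟨_, z, l, hz, rfl, h, hl⟩
  have hγmin := fun γ (hγ : γ < Nat.find hex) => Nat.find_min hex hγ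
  have hex' : ∃ l z, IsNode H z ∧ sccCyclicity H z = Nat.find hex ∧ WalkThrough D u i j c z l ∧
      l ≡ t [MOD Nat.find hex] := by
    obtain ⟨z, l, h⟩ := Nat.find_spec hex
    exact ⟨l, z, h⟩
  generalize Nat.find hex = γ at hγmin hex'
  obtain ⟨v, hv, hvγ, ⟨p, q, hpq, hc⟩, hmod⟩ := Nat.find_spec hex'
  have hlmin := fun l (hl : l < Nat.find hex') => Nat.find_min hex' hl
  generalize Nat.find hex' = L at hlmin hpq hmod
  have hvc := exists_closedWalk_of_isNode hN.sameScc hv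
  have hγ0 : 0 < γ := hvγ ▸ sccCyclicity_pos hvc
  set Z : Finset (Fin n) := Finset.univ.filter fun w => IsNode H w ∧ sccCyclicity H w ≤ γ with hZ
  have hvZ : v ∈ Z := by simp [hZ, hv, hvγ]
  have hmin := length_le_of_minimal hN.closed_nonpos hγ0 p q hc Z hvZ (by
    intro w hw hws l hlt hlmod hwt
    obtain ⟨hwH, hwγ⟩ : IsNode H w ∧ sccCyclicity H w ≤ γ := by simpa [hZ] using hw
    rw [hpq] at hlt hlmod
    rcases hwγ.eq_or_lt with heq | hlt'
    · exact hlmin l hlt ⟨w, hwH, heq, hwt, hlmod.trans hmod⟩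
    · have hw0 := sccCyclicity_pos (exists_closedWalk_of_isNode hN.sameScc hwH)
      -- If the walk met a node `w` of smaller cyclicity, a closed walk inserted at `v` would make
      -- its length congruent to `t` modulo both cyclicities. The mark could then move to `w`,
      -- against the choice of `γ`.
      obtain ⟨d, hd⟩ := hN.exists_closedWalk_modEq hv (hvγ ▸ hmod)
        (Nat.mul_pos hγ0 hw0) (hvγ ▸ dvd_mul_right _ _)
      obtain ⟨d', hd', hd0⟩ := hN.exists_lift d
      have hmem : w ∈ (p.append (d'.append q)).support := by
        rw [Walk.mem_support_append] at hws ⊢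
        rw [Walk.mem_support_append]
        tauto
      obtain ⟨a, b, hab, -⟩ := (p.append (d'.append q)).exists_split hmem
      have hlen := congrArg Walk.length hab
      have hwt' := congrArg (Walk.realWeight u) hab
      simp only [Walk.length_append, Walk.realWeight_append] at hlen hwt'
      refine hγmin _ hlt' ⟨w, L + d.length, hwH, rfl, ⟨a, b, by omega, by linarith⟩, ?_⟩
      exact hd.of_mul_left _)
  obtain ⟨hr1, hr2⟩ := roundedExplorationPenalty_spec hvc
  have hre := nodeRoundedExplorationPenalty_le hv
  have hγle := sccCyclicity_le_maxCyclicity hv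
  rw [hvγ] at hr1 hr2 hre hγle
  set r := nodeRoundedExplorationPenalty H γ v
  have hZle : Z.card ≤ nodeCount H := by
    unfold nodeCount
    exact Finset.card_le_card fun w hw => by simp [hZ] at hw ⊢; exact hw.1
  have hnc : nodeCount H ≤ n := by
    unfold nodeCount
    exact (Finset.card_le_univ _).trans (by simp)
  have hZ1 : 1 ≤ Z.card := Finset.card_pos.2 ⟨v, hvZ⟩
  rw [hpq] at hmin
  -- Since `r` is a multiple of `γ`, it suffices that `L + r < t + γ`. If `γ` is the greatest
  -- cyclicity, `Z` contains all critical nodes. Otherwise the `n - 1` gained from the smaller `γ`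
  -- pays for the at most `n - 1` critical nodes outside `Z`.
  have hle : L + r ≤ t := by
    refine le_of_modEq_of_lt_add (m := γ) ?_ ?_
    · exact (Nat.ModEq.add_left L ((Nat.modEq_zero_iff_dvd).2 hr1)).trans hmod
    · have hn : 1 ≤ n := hZ1.trans (hZle.trans hnc)
      rcases hγle.eq_or_lt with heq | hlt
      · have hZeq : nodeCount H ≤ Z.card := by
          unfold nodeCount
          refine Finset.card_le_card fun w hw => ?_
          simp only [Finset.mem_filter, Finset.mem_univ, true_and] at hw
          simp [hZ, hw, heq, sccCyclicity_le_maxCyclicity hw]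
        rw [← heq] at ht
        omega
      · obtain ⟨e, he⟩ := Nat.exists_eq_add_of_lt hlt
        obtain ⟨k, rfl⟩ := Nat.exists_eq_add_of_le hn
        rw [he] at ht
        nlinarith [Nat.zero_le (e * k)]
  obtain ⟨d, hd⟩ := hr2 (t - L)
    ((Nat.modEq_iff_dvd' (by omega)).1 hmod) (by omega)
  refine ⟨v, hv, ?_⟩
  have := hN.insert ⟨p, q, hpq, hc⟩ d
  rwa [hd, Nat.add_sub_cancel' (by omega)] at this

end IsNormalized

/-! ### Hamiltonian critical cycles -/

/-- A list any two of whose entries are related one way or the other can be rearranged into a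
chain. -/
theorem exists_perm_isChain {α : Type*} (R : α → α → Prop) (l : List α)
    (hl : l.Pairwise fun a b => R a b ∨ R b a) : ∃ l' : List α, l'.Perm l ∧ l'.IsChain R := by
  -- As for Hamiltonian paths in tournaments, `a` is put before the first entry that it can precede.
  -- The last clause says that the new chain can still follow whatever preceded the old one,
  -- provided this is also related to `a`.
  have insert (a : α) (l : List α) (hc : l.IsChain R) (ha : ∀ b ∈ l, R a b ∨ R b a) :
      ∃ l' : List α, l'.Perm (a :: l) ∧ l'.IsChain R ∧
        ∀ b, R b a → (b :: l).IsChain R → (b :: l').IsChain R := by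
    induction l with
    | nil => exact ⟨[a], List.Perm.refl _, by simp, by simp⟩
    | cons b s ih =>
      by_cases hab : R a b
      · exact ⟨a :: b :: s, List.Perm.refl _, List.isChain_cons_cons.2 ⟨hab, hc⟩,
          fun c hca _ => List.isChain_cons_cons.2 ⟨hca, List.isChain_cons_cons.2 ⟨hab, hc⟩⟩⟩
      · have hba : R b a := (ha b (by simp)).resolve_left hab
        obtain ⟨l', h1, -, h3⟩ := ih hc.tail fun x hx => ha x (by simp [hx])
        refine ⟨b :: l', (h1.cons b).trans (List.Perm.swap a b s), h3 b hba hc, fun c _ h => ?_⟩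
        exact List.isChain_cons_cons.2 ⟨(List.isChain_cons_cons.1 h).1, h3 b hba hc⟩
  induction l with
  | nil => exact ⟨[], List.Perm.refl _, by simp⟩
  | cons a l ih =>
    obtain ⟨h1, h2⟩ := List.pairwise_cons.1 hl
    obtain ⟨l', h3, h4⟩ := ih h2
    obtain ⟨l'', h5, h6, -⟩ := insert a l' h4 fun b hb => h1 b (h3.subset hb)
    exact ⟨l'', h5.trans (h3.cons a), h6⟩

theorem Walk.isChain_support {V : Type} {G : Digraph V} {i j : V} (p : Walk G i j) :
    p.support.IsChain G.Adj := by
  induction p with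
  | nil => simp
  | cons h p ih =>
    rw [Walk.support_cons, p.support_eq_cons]
    rw [p.support_eq_cons] at ih
    exact List.isChain_cons_cons.2 ⟨h, ih⟩

theorem Walk.getElem_support_length {V : Type} {G : Digraph V} {i j : V} (p : Walk G i j) :
    p.support[p.length]'(by rw [p.length_support]; omega) = j := by
  induction p with
  | nil => rfl
  | cons h p ih => simpa using ih

/-- Positions along a Hamiltonian cycle. -/
theorem exists_positions {n : ℕ} [NeZero n] {H : Digraph (Fin n)} {w : Fin n} (p : Walk H w w)
    (hp : p.IsCycle) (hn : p.length = n) :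
    ∃ pos : Fin n → ZMod n, Function.Bijective pos ∧
      ∀ a b, pos b = pos a + 1 → H.Adj a b := by
  have hlen : p.support.length = n + 1 := by rw [p.length_support, hn]
  have hchain := List.isChain_iff_getElem.1 p.isChain_support
  -- The initial copy of the base is skipped, so each node occurs exactly once.
  set f : Fin n → Fin n := fun k => p.support[(k : ℕ) + 1]'(by omega) with hf
  have hfinj : Function.Injective f := by
    intro a b hab
    have hnd := hp.2
    have h := (List.Nodup.getElem_inj_iff hnd (i := a) (j := b)
      (hi := by simp [hlen]) (hj := by simp [hlen])).1 (by simpa [hf] using hab)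
    exact Fin.ext h
  have hfbij : Function.Bijective f := Finite.injective_iff_bijective.1 hfinj
  set e := Equiv.ofBijective f hfbij with he
  have hcast : Function.Bijective (fun k : Fin n => ((k : ℕ) : ZMod n)) := by
    rw [Fintype.bijective_iff_injective_and_card]
    refine ⟨fun a b hab => Fin.ext ?_, by simp [ZMod.card]⟩
    have := (ZMod.natCast_eq_natCast_iff' _ _ _).1 hab
    rwa [Nat.mod_eq_of_lt a.isLt, Nat.mod_eq_of_lt b.isLt] at this
  refine ⟨fun a => ((e.symm a : ℕ) : ZMod n), hcast.comp e.symm.bijective, fun a b hab => ?_⟩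
  obtain ⟨x, rfl⟩ := e.surjective a
  obtain ⟨y, rfl⟩ := e.surjective b
  simp only [Equiv.symm_apply_apply] at hab
  have hx := x.isLt
  have hy := y.isLt
  have hxy : (y : ℕ) % n = ((x : ℕ) + 1) % n := by
    refine (ZMod.natCast_eq_natCast_iff' _ _ _).1 ?_
    rw [hab]; push_cast; rfl
  rw [Nat.mod_eq_of_lt hy] at hxy
  show H.Adj (f x) (f y)
  rcases Nat.lt_or_ge ((x : ℕ) + 1) n with h | h
  · rw [Nat.mod_eq_of_lt h] at hxy
    simp only [hf, hxy]
    exact hchain (x + 1) (by omega)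
  -- The last position holds the base `w`, which is also the start of the support; the step wraps
  -- around.
  · have hx1 : (x : ℕ) + 1 = n := by omega
    rw [hx1, Nat.mod_self] at hxy
    have h1 : f x = w := by
      have := p.getElem_support_length
      simp only [hf, hx1]
      simpa only [hn] using this
    have h2 : w = p.support[0]'(by omega) := by
      cases p <;> rfl
    rw [h1]
    simp only [hf, hxy]
    conv => arg 2; rw [h2]
    exact hchain 0 (by omega)

section Positions

variable {n : ℕ} {D H : Digraph (Fin n)} {pos : Fin n → ZMod n}

theorem exists_walk_of_positions (hpos : Function.Bijective pos)
    (hadj : ∀ a b, pos b = pos a + 1 → H.Adj a b) (r : ℕ) (a b : Fin n)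
    (h : pos b = pos a + r) : ∃ p : Walk H a b, p.length = r := by
  induction r generalizing a with
  | zero =>
    obtain rfl : b = a := hpos.1 (by simpa using h)
    exact ⟨Walk.nil b, rfl⟩
  | succ r ih =>
    obtain ⟨a', ha'⟩ := hpos.2 (pos a + 1)
    obtain ⟨p, hp⟩ := ih a' (by rw [h, ha']; push_cast; ring)
    exact ⟨Walk.cons (hadj a a' ha') p, by simp [hp]⟩

theorem exists_short_walk_of_positions [NeZero n] (hpos : Function.Bijective pos)
    (hadj : ∀ a b, pos b = pos a + 1 → H.Adj a b) (a b : Fin n) :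
    ∃ p : Walk H a b, p.length < n ∧ (p.length : ZMod n) = pos b - pos a := by
  obtain ⟨p, hp⟩ := exists_walk_of_positions hpos hadj (pos b - pos a).val a b (by
    rw [ZMod.natCast_zmod_val]; ring)
  exact ⟨p, hp ▸ ZMod.val_lt _, by rw [hp, ZMod.natCast_zmod_val]⟩

/-- How far the edge deviates from a step along the Hamiltonian cycle. -/
def jump (pos : Fin n → ZMod n) (e : Fin n × Fin n) : ZMod n := pos e.2 - pos e.1 - 1

/-- The sum telescopes. Between fixed ends the length modulo `n` is thus determined by the total
jump, which only the edges off the Hamiltonian cycle contribute to. -/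
theorem Walk.sum_jump {i j : Fin n} (p : Walk D i j) :
    (p.edges.map (jump pos)).sum = pos j - pos i - p.length := by
  induction p with
  | nil => simp
  | cons h p ih => simp [ih, jump]; ring

/-- A chain of edges is joined by pieces of the Hamiltonian cycle into a walk. -/
theorem IsNormalized.exists_walk_of_chain [NeZero n] {u : Fin n → Fin n → ℝ} (hN : IsNormalized D H u)
    (hpos : Function.Bijective pos) (hadj : ∀ a b, pos b = pos a + 1 → H.Adj a b) (j : Fin n)
    (l : List (Fin n × Fin n)) (e : Fin n × Fin n) (hD : ∀ f ∈ e :: l, D.Adj f.1 f.2)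
    (hl : (e :: l).IsChain fun f g => pos g.1 ≠ pos f.2 - 1) :
    ∃ p : Walk D e.1 j, p.length ≤ 1 + l.length * (n - 1) + (n - 1) ∧
      p.realWeight u = ((e :: l).map fun f => u f.1 f.2).sum ∧
      (p.length : ZMod n) = pos j - pos e.1 - ((e :: l).map (jump pos)).sum := by
  have hn : 0 < n := Nat.pos_of_ne_zero (NeZero.ne n)
  induction l generalizing e with
  | nil =>
    obtain ⟨q, hq1, hq2⟩ := exists_short_walk_of_positions hpos hadj e.2 j
    obtain ⟨q', h1, h2⟩ := hN.exists_lift q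
    refine ⟨Walk.cons (hD e (by simp)) q', by simp; omega, by simp [h2], ?_⟩
    simp [h1, hq2, jump]; ring
  | cons f l ih =>
    obtain ⟨q, hq1, hq2⟩ := exists_short_walk_of_positions hpos hadj e.2 f.1
    obtain ⟨q', h1, h2⟩ := hN.exists_lift q
    obtain ⟨hef, hl'⟩ := List.isChain_cons_cons.1 hl
    obtain ⟨r, hr1, hr2, hr3⟩ := ih f (fun g hg => hD g (by simp [List.mem_cons.1 hg])) hl'
    -- The chain condition excludes exactly the arc of length `n - 1`, so each further edge together
    -- with the arc leading to it costs at most `n - 1`.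
    have hne : q.length ≠ n - 1 := by
      intro h
      rw [h, Nat.cast_sub hn, ZMod.natCast_self] at hq2
      apply hef
      push_cast at hq2
      linear_combination -hq2
    refine ⟨Walk.cons (hD e (by simp)) (q'.append r), ?_, ?_, ?_⟩
    · simp only [Walk.length_cons, Walk.length_append, List.length_cons, h1, add_mul]
      omega
    · simp [h2, hr2]
    · simp only [Walk.length_cons, Walk.length_append, Nat.cast_add, h1, hq2, hr3, jump,
        List.map_cons, List.sum_cons]
      push_cast
      ring

/-- If the critical graph contains a Hamiltonian cycle, few other edges are needed. -/
theorem IsNormalized.exists_short_walk [NeZero n] {u : Fin n → Fin n → ℝ} (hN : IsNormalized D H u)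
    (hpos : Function.Bijective pos) (hadj : ∀ a b, pos b = pos a + 1 → H.Adj a b) {i j : Fin n}
    (p : Walk D i j) : ∃ q : Walk D i j, q.length ≡ p.length [MOD n] ∧
      p.realWeight u ≤ q.realWeight u ∧ q.length ≤ (n - 1) ^ 2 + n := by
  classical
  have hn : 0 < n := Nat.pos_of_ne_zero (NeZero.ne n)
  -- Every edge is closed up by a free arc of the Hamiltonian cycle.
  have hu (a b : Fin n) (h : D.Adj a b) : u a b ≤ 0 := by
    obtain ⟨q, -, -⟩ := exists_short_walk_of_positions hpos hadj b a
    obtain ⟨q', -, h2⟩ := hN.exists_lift q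
    simpa [h2] using hN.closed_nonpos a (Walk.cons h q')
  set σ : ZMod n := (p.edges.map (jump pos)).sum with hσ
  -- Of the edges of `p`, as few as possible are kept with the same total jump. Then no nonempty
  -- selection of them has zero total jump, so there are fewer than `n`.
  have hex : ∃ (m : ℕ) (F : List (Fin n × Fin n)), F.length = m ∧ F.Subperm p.edges ∧
      (F.map (jump pos)).sum = σ := ⟨_, p.edges, rfl, List.Subperm.refl _, rfl⟩
  obtain ⟨F, hFm, hF, hFσ⟩ := Nat.find_spec hex
  have hfree : ∀ K : List (Fin n × Fin n), K.Sublist F → K ≠ [] → (K.map (jump pos)).sum ≠ 0 := by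
    intro K hK hK0 hsum
    obtain ⟨K', hK'⟩ := hK.exists_perm_append
    have hKlen : 0 < K.length := List.length_pos_of_ne_nil hK0
    have hlen := hK'.length_eq
    rw [List.length_append] at hlen
    refine Nat.find_min hex (m := K'.length) (by omega) ⟨K', rfl, ?_, ?_⟩
    · exact ((List.sublist_append_right K K').subperm.trans hK'.symm.subperm).trans hF
    · rw [← hFσ, (hK'.map _).sum_eq, List.map_append, List.sum_append, hsum, zero_add]
  have hFn : F.length < n := by
    by_contra! h
    obtain ⟨K, h1, h2, h3⟩ := exists_sublist_sum_eq_zero (jump pos) F h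
    exact hfree K h1 h2 h3
  obtain ⟨F', hF', hchain⟩ := exists_perm_isChain
    (fun f g : Fin n × Fin n => pos g.1 ≠ pos f.2 - 1) F (by
      -- If neither of two edges could follow the other in the chain, their jumps would sum to zero.
      refine List.pairwise_iff_forall_sublist.2 fun {a b} hab => ?_
      by_contra! h
      refine hfree [a, b] hab (by simp) ?_
      simp only [jump, List.map_cons, List.map_nil, List.sum_cons, List.sum_nil]
      rw [h.1, h.2]; ring)
  have hweight : p.realWeight u ≤ (F'.map fun f => u f.1 f.2).sum := by
    obtain ⟨F₁, hF₁, hsub⟩ := hF'.subperm.trans hF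
    obtain ⟨K, hK⟩ := hsub.exists_perm_append
    replace hK := hK.trans (hF₁.append_right K)
    have hle : (K.map fun f => u f.1 f.2).sum ≤ 0 := by
      have h := List.sum_le_card_nsmul (K.map fun f => u f.1 f.2) 0 (by
        intro x hx
        obtain ⟨f, hf, rfl⟩ := List.mem_map.1 hx
        exact hu _ _ (p.adj_of_mem_edges (hK.symm.subset (List.mem_append_right _ hf))))
      simpa using h
    unfold Walk.realWeight
    rw [(hK.map _).sum_eq, List.map_append, List.sum_append]
    linarith
  have hsum : (F'.map (jump pos)).sum = σ := by rw [(hF'.map _).sum_eq, hFσ]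
  have hD : ∀ f ∈ F', D.Adj f.1 f.2 := fun f hf =>
    p.adj_of_mem_edges (hF.subset (hF'.subset hf))
  rw [← hF'.length_eq] at hFn
  have hmod (q : Walk D i j) (hq : (q.length : ZMod n) = pos j - pos i - (F'.map (jump pos)).sum) :
      q.length ≡ p.length [MOD n] := by
    rw [← ZMod.natCast_eq_natCast_iff, hq, hsum, hσ, p.sum_jump]
    ring
  obtain ⟨m, hm⟩ : ∃ m, n = m + 1 := ⟨n - 1, by omega⟩
  cases F' with
  | nil =>
    obtain ⟨q, hq1, hq2⟩ := exists_short_walk_of_positions hpos hadj i j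
    obtain ⟨q', h1, h2⟩ := hN.exists_lift q
    exact ⟨q', hmod q' (by simp [h1, hq2]), by rw [h2]; simpa using hweight,
      by rw [h1]; exact hq1.le.trans (Nat.le_add_left _ _)⟩
  | cons e l =>
    obtain ⟨q, hq1, hq2⟩ := exists_short_walk_of_positions hpos hadj i e.1
    obtain ⟨q', h1, h2⟩ := hN.exists_lift q
    obtain ⟨r, hr1, hr2, hr3⟩ := hN.exists_walk_of_chain hpos hadj j l e hD hchain
    refine ⟨q'.append r, hmod _ ?_, ?_, ?_⟩
    · rw [Walk.length_append, Nat.cast_add, h1, hq2, hr3]; ring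
    · rw [Walk.realWeight_append, h2, hr2, zero_add]; exact hweight
    -- The initial arc has at most `n - 1` edges and at most `n - 1` edges are kept: `(n - 1) + 1 +
    -- (n - 1)(n - 1)`.
    · rw [Walk.length_append, h1]
      simp only [List.length_cons] at hFn
      have h3 : (l.length + 1) * (n - 1) ≤ (n - 1) * (n - 1) := Nat.mul_le_mul_right _ (by omega)
      rw [pow_two]
      rw [add_mul] at h3
      omega

end Positions

theorem IsNormalized.walkThrough_of_hamiltonian {n : ℕ} {D H : Digraph (Fin n)}
    {u : Fin n → Fin n → ℝ} {i j : Fin n} {c : ℝ} (hN : IsNormalized D H u) {z : Fin n}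
    (hz : IsNode H z) {l t : ℕ} (h : WalkThrough D u i j c z l)
    (hl : l ≡ t [MOD sccCyclicity H z]) (hg : sccGirth H z = n) (ht : (n - 1) ^ 2 + 1 ≤ t) :
    ∃ w, IsNode H w ∧ WalkThrough D u i j c w t := by
  obtain ⟨w, p, l', hp, hpl, ⟨a, b, hab, hc⟩, h2⟩ := hN.exists_walkThrough_girth hz h hl
  rw [hg] at hpl h2
  have hn : 0 < n := hpl ▸ hp.1
  have : NeZero n := ⟨hn.ne'⟩
  obtain ⟨pos, hpos, hadj⟩ := exists_positions p hp hpl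
  obtain ⟨q, hq1, hq2, hq3⟩ := hN.exists_short_walk hpos hadj (a.append b)
  rw [Walk.length_append, hab] at hq1
  rw [Walk.realWeight_append] at hq2
  -- Once around the cycle shows that `i` itself lies in `H`, so the mark may be put at the start of
  -- the walk.
  obtain ⟨d, hd⟩ := exists_walk_of_positions hpos hadj n i i (by simp)
  have hq : WalkThrough D u i j c i q.length := ⟨Walk.nil i, q, by simp, by simp; linarith⟩
  exact ⟨i, isNode_of_closedWalk d (by omega),
    hN.extend hq d hd (hq1.trans h2) (le_of_modEq_of_lt_add (hq1.trans h2) (by omega))⟩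

/-- The time from which walks through the critical graph can be given any length in their class. -/
theorem IsNormalized.walkThrough_of_bounds {n : ℕ} {D H : Digraph (Fin n)}
    {u : Fin n → Fin n → ℝ} {i j : Fin n} {c : ℝ} (hN : IsNormalized D H u) {z : Fin n}
    (hz : IsNode H z) {l t : ℕ} (h : WalkThrough D u i j c z l)
    (hl : l ≡ t [MOD sccCyclicity H z])
    (ht : wielandt n ≤ t ∨
      (maxGirth H : ℤ) * ((n : ℤ) - 2) + n ≤ t ∨
      ((maxGirth H : ℤ) - 1) * ((circumference D : ℤ) - 1) +
        ((maxGirth H : ℤ) + 1) * cabDriverDiameter D ≤ t ∨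
      (maxCyclicity H : ℤ) * ((n : ℤ) - 1) + n - nodeCount H + roundedExplorationPenalty H ≤ t ∨
      ((maxCyclicity H : ℤ) - 1) * ((circumference D : ℤ) - 1) +
        ((maxCyclicity H : ℤ) + 1) * cabDriverDiameter D + explorationPenalty H ≤ t) :
    ∃ w, IsNode H w ∧ WalkThrough D u i j c w t := by
  have hc := exists_closedWalk_of_isNode hN.sameScc hz
  obtain ⟨w, p, hp, hzw, hpl⟩ := exists_girth_cycle hc
  have hgn : sccGirth H z ≤ n := hpl ▸ hp.length_le
  have hg0 : 0 < sccGirth H z := hpl ▸ hp.1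
  have hgm := sccGirth_le_maxGirth hz
  have hγ0 := sccCyclicity_pos hc
  have hγm := sccCyclicity_le_maxCyclicity hz
  have hγg : sccCyclicity H z ≤ sccGirth H z := by
    refine Nat.le_of_dvd hg0 ?_
    rw [sccCyclicity_congr hzw, ← hpl]
    exact sccCyclicity_dvd_length
      (exists_closedWalk_of_isNode hN.sameScc (hz.of_sameScc hzw)) p
  have hgcr : sccGirth H z ≤ circumference D := by
    obtain ⟨q, -, hq, hqs⟩ := p.exists_map hN.le
    rw [← hpl, ← hq]
    exact length_le_circumference ⟨hq ▸ hp.1, hqs ▸ hp.2⟩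
  have hn0 : 0 < n := hg0.trans_le hgn
  -- Raising the girth to `g` weakens the bound only if `n ≥ 2`; for `n = 1` the factor `n - 2` is
  -- negative and `g` must be exact.
  have girthBound (g : ℤ) (hg : (sccGirth H z : ℤ) ≤ g)
      (h1 : g * ((n : ℤ) - 2) + n ≤ t) (h2 : n = 1 → g = 1) :
      ∃ w, IsNode H w ∧ WalkThrough D u i j c w t := by
    refine hN.walkThrough_of_girth hz h hl ?_
    zify
    rcases Nat.lt_or_ge n 2 with hn | hn
    · obtain rfl : n = 1 := by omega
      have := h2 rfl
      push_cast at *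
      nlinarith
    · have : (sccGirth H z : ℤ) * ((n : ℤ) - 2) ≤ g * ((n : ℤ) - 2) :=
        mul_le_mul_of_nonneg_right hg (by omega)
      linarith
  rcases ht with ht | ht | ht | ht | ht
  · unfold wielandt at ht
    split_ifs at ht with hn
    · obtain rfl : n = 1 := by omega
      exact girthBound 1 (by omega) (by simp) (fun _ => rfl)
    · rcases hgn.eq_or_lt with heq | hlt
      · exact hN.walkThrough_of_hamiltonian hz h hl heq ht
      -- Here the girth is at most `n - 1`, and `(n - 1)(n - 2) + n = (n - 1)^2 + 1`.
      · refine girthBound ((n : ℤ) - 1) (by omega) ?_ (by omega)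
        obtain ⟨m, rfl⟩ : ∃ m, n = m + 1 := ⟨n - 1, by omega⟩
        zify at ht
        push_cast at ht ⊢
        simp only [add_sub_cancel_right] at ht ⊢
        nlinarith
  · classical
    refine girthBound _ (by exact_mod_cast hgm) ht ?_
    rintro rfl
    have hle : maxGirth H ≤ 1 := by
      unfold maxGirth
      refine Finset.sup_le fun k hk => ?_
      obtain ⟨w, p, hp, -, hpl⟩ := exists_girth_cycle
        (exists_closedWalk_of_isNode hN.sameScc (Finset.mem_filter.1 hk).2)
      exact hpl ▸ hp.length_le
    omega
  · refine hN.walkThrough_of_girth_cabDriverDiameter hz h hl ?_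
    have hcr : 1 ≤ circumference D := by omega
    zify at *
    -- If the girth is at least `2`, so is the circumference, and the product absorbs the term `g -
    -- 1`; for girth `1` that term vanishes.
    have h1 : ((sccGirth H z : ℤ) - 1) * 1 ≤
        ((sccGirth H z : ℤ) - 1) * ((circumference D : ℤ) - 1) ∨ (sccGirth H z : ℤ) = 1 := by
      by_cases h : (sccGirth H z : ℤ) = 1
      · exact Or.inr h
      · exact Or.inl (mul_le_mul_of_nonneg_left (by omega) (by omega))
    have h2 : ((sccGirth H z : ℤ) - 1) * ((circumference D : ℤ) - 1) ≤
        ((maxGirth H : ℤ) - 1) * ((circumference D : ℤ) - 1) :=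
      mul_le_mul_of_nonneg_right (by omega) (by omega)
    have h3 : ((sccGirth H z : ℤ) + 1) * cabDriverDiameter D ≤
        ((maxGirth H : ℤ) + 1) * cabDriverDiameter D :=
      mul_le_mul_of_nonneg_right (by omega) (by omega)
    rcases h1 with h1 | h1
    · linarith
    · rw [h1] at h2 h3 ⊢
      linarith
  · refine hN.walkThrough_of_roundedExplorationPenalty hz h hl ?_
    zify
    linarith
  · refine ⟨z, hz, hN.walkThrough_of_explorationPenalty hz h hl ?_⟩
    have hcr : 1 ≤ circumference D := by omega
    have hep := nodeExplorationPenalty_le hz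
    zify at *
    have h1 : ((sccCyclicity H z : ℤ) - 1) * 1 ≤
        ((sccCyclicity H z : ℤ) - 1) * ((circumference D : ℤ) - 1) ∨
        (sccCyclicity H z : ℤ) = 1 := by
      by_cases h : (sccCyclicity H z : ℤ) = 1
      · exact Or.inr h
      · exact Or.inl (mul_le_mul_of_nonneg_left (by omega) (by omega))
    have h2 : ((sccCyclicity H z : ℤ) - 1) * ((circumference D : ℤ) - 1) ≤
        ((maxCyclicity H : ℤ) - 1) * ((circumference D : ℤ) - 1) :=
      mul_le_mul_of_nonneg_right (by omega) (by omega)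
    have h3 : ((sccCyclicity H z : ℤ) + 1) * cabDriverDiameter D ≤
        ((maxCyclicity H : ℤ) + 1) * cabDriverDiameter D :=
      mul_le_mul_of_nonneg_right (by omega) (by omega)
    rcases h1 with h1 | h1
    · linarith
    · rw [h1] at h2 h3
      rw [h1]
      linarith

/-! ### Matrix powers and walks -/

/-- The entries of a matrix as real numbers (`0` in place of `-∞`). -/
def realEntry {n : ℕ} (A : Matrix (Fin n) (Fin n) (WithBot ℝ)) (i j : Fin n) : ℝ :=
  (A i j).unbotD 0

section Powers

variable {n : ℕ} {A B : Matrix (Fin n) (Fin n) (WithBot ℝ)} {G : Digraph (Fin n)} {i j : Fin n}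

theorem coe_realEntry (h : A i j ≠ ⊥) : ((realEntry A i j : ℝ) : WithBot ℝ) = A i j := by
  unfold realEntry
  obtain ⟨r, hr⟩ := WithBot.ne_bot_iff_exists.1 h
  rw [← hr, WithBot.unbotD_coe]

@[simp] theorem weight_nil (A : Matrix (Fin n) (Fin n) (WithBot ℝ)) (i : Fin n) :
    weight A (Walk.nil i : Walk G i i) = 0 := by
  simp [weight]

@[simp] theorem weight_cons (A : Matrix (Fin n) (Fin n) (WithBot ℝ)) {k : Fin n} (h : G.Adj i j)
    (p : Walk G j k) : weight A (Walk.cons h p) = A i j + weight A p := by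
  simp [weight]

@[simp] theorem weight_append (A : Matrix (Fin n) (Fin n) (WithBot ℝ)) {k : Fin n} (p : Walk G i j)
    (q : Walk G j k) : weight A (p.append q) = weight A p + weight A q := by
  simp [weight]

theorem weight_eq_coe {u : Fin n → Fin n → ℝ} (p : Walk G i j)
    (h : ∀ e ∈ p.edges, A e.1 e.2 = (u e.1 e.2 : ℝ)) :
    weight A p = ((p.realWeight u : ℝ) : WithBot ℝ) := by
  induction p with
  | nil => simp
  | @cons i k j hik p ih =>
    rw [weight_cons, Walk.realWeight_cons, ih fun e he => h e (by simp [he]),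
      h (i, k) (by simp), WithBot.coe_add]

theorem weight_eq_coe_realEntry (p : Walk (digraph A) i j) :
    weight A p = ((p.realWeight (realEntry A) : ℝ) : WithBot ℝ) :=
  weight_eq_coe p fun _ he => (coe_realEntry (p.adj_of_mem_edges he)).symm

theorem add_le_mul (A B : Matrix (Fin n) (Fin n) (WithBot ℝ)) (i k j : Fin n) :
    A i k + B k j ≤ mul A B i j :=
  Finset.le_sup (f := fun k => A i k + B k j) (Finset.mem_univ k)

theorem exists_mul_eq (A B : Matrix (Fin n) (Fin n) (WithBot ℝ)) (i j : Fin n) :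
    ∃ k, mul A B i j = A i k + B k j := by
  obtain ⟨k, -, hk⟩ := Finset.exists_mem_eq_sup Finset.univ ⟨i, Finset.mem_univ i⟩
    fun k => A i k + B k j
  exact ⟨k, hk⟩

/-- The initial power is kept general because powers grow on the right while walks are built from
the left. -/
theorem pow_add_weight_le (A : Matrix (Fin n) (Fin n) (WithBot ℝ)) (l : ℕ) (i : Fin n)
    {k j : Fin n} (p : Walk G k j) : pow A l i k + weight A p ≤ pow A (l + p.length) i j := by
  induction p generalizing l with
  | nil => simp
  | @cons k m j h p ih =>
    rw [weight_cons, ← add_assoc, Walk.length_cons, add_comm p.length, ← add_assoc]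
    exact (add_le_add_left (add_le_mul (pow A l) A i k m) _).trans (ih (l + 1))

theorem weight_le_pow (A : Matrix (Fin n) (Fin n) (WithBot ℝ)) (p : Walk G i j) :
    weight A p ≤ pow A p.length i j := by
  have := pow_add_weight_le A 0 i p
  simpa [pow, one] using this

theorem exists_walk_of_pow_ne_bot {t : ℕ} (h : pow A t i j ≠ ⊥) :
    ∃ p : Walk (digraph A) i j, p.length = t ∧ weight A p = pow A t i j := by
  induction t generalizing j with
  | zero =>
    by_cases hij : i = j
    · subst hij
      exact ⟨Walk.nil i, rfl, by simp [pow, one]⟩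
    · simp [pow, one, hij] at h
  | succ t ih =>
    obtain ⟨k, hk⟩ := exists_mul_eq (pow A t) A i j
    change pow A (t + 1) i j = _ at hk
    rw [hk] at h ⊢
    rw [Ne, WithBot.add_eq_bot, not_or] at h
    obtain ⟨p, hp, hw⟩ := ih h.1
    have hadj : (digraph A).Adj k j := h.2
    exact ⟨p.append (Walk.cons hadj (Walk.nil j)), by simp [hp], by simp [hw]⟩

end Powers

/-! ### Visualization -/

section Visualization

variable {n : ℕ} {A : Matrix (Fin n) (Fin n) (WithBot ℝ)} {lam : ℝ}

theorem realWeight_le_of_isCycle (hlam : maxCycleMean A = lam) {i : Fin n}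
    (p : Walk (digraph A) i i) (hp : p.IsCycle) :
    p.realWeight (realEntry A) ≤ p.length * lam := by
  have hlen : (0 : ℝ) < p.length := by exact_mod_cast hp.1
  have hmem (q : ℝ) (x : WithBot ℝ) {k : Fin n} (p : Walk (digraph A) k k) (hp : p.IsCycle)
      (hx : p.length • x = weight A p) (hq : ∀ a b, realEntry A a b ≤ q) : x ≤ (q : ℝ) := by
    have hlen : (0 : ℝ) < p.length := by exact_mod_cast hp.1
    rw [weight_eq_coe_realEntry] at hx
    induction x with
    | bot => exact bot_le
    | coe r =>
      rw [← WithBot.coe_nsmul, WithBot.coe_inj, nsmul_eq_mul] at hx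
      have h1 := p.realWeight_le (u := realEntry A) (v := fun _ _ => q) fun e _ => hq _ _
      rw [Walk.realWeight_const, ← hx] at h1
      exact WithBot.coe_le_coe.2 (le_of_mul_le_mul_left h1 hlen)
  -- A supremum in `WithBot ℝ` has its usual meaning only for sets bounded above; cycle means do not
  -- exceed the sum of the absolute values of all entries.
  have hbdd : BddAbove {x | ∃ (i : Fin n) (p : Walk (digraph A) i i), p.IsCycle ∧
      p.length • x = weight A p} := by
    refine ⟨((∑ a, ∑ b, |realEntry A a b| : ℝ) : WithBot ℝ), ?_⟩
    rintro x ⟨k, q, hq, hx⟩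
    refine hmem _ x q hq hx fun a b => (le_abs_self _).trans ?_
    refine (Finset.single_le_sum (f := fun b => |realEntry A a b|)
      (fun _ _ => abs_nonneg _) (Finset.mem_univ b)).trans ?_
    exact Finset.single_le_sum (f := fun a => ∑ b, |realEntry A a b|)
      (fun _ _ => Finset.sum_nonneg fun _ _ => abs_nonneg _) (Finset.mem_univ a)
  have h := le_csSup hbdd (a := ((p.realWeight (realEntry A) / p.length : ℝ) : WithBot ℝ))
    ⟨i, p, hp, by
      rw [weight_eq_coe_realEntry, ← WithBot.coe_nsmul, nsmul_eq_mul, mul_div_cancel₀ _ hlen.ne']⟩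
  change _ ≤ maxCycleMean A at h
  rw [hlam, WithBot.coe_le_coe, div_le_iff₀ hlen] at h
  linarith

theorem Walk.realWeight_normalize {G : Digraph (Fin n)} {i j : Fin n} (p : Walk G i j)
    (u : Fin n → Fin n → ℝ) (m : ℝ) (x : Fin n → ℝ) :
    p.realWeight (fun a b => u a b - m + (x b - x a)) =
      p.realWeight u - p.length * m + (x j - x i) := by
  induction p with
  | nil => simp
  | cons h p ih => simp only [Walk.realWeight_cons, ih, Walk.length_cons]; push_cast; ring

/-- The weights can be rescaled so that they do not exceed the maximum cycle mean. -/
theorem exists_potential (hlam : maxCycleMean A = lam) :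
    ∃ x : Fin n → ℝ, ∀ a b, (digraph A).Adj a b → realEntry A a b - lam + (x b - x a) ≤ 0 := by
  -- The vacuous `0 - 0` gives `u` the shape of `realWeight_normalize` for the zero potential.
  set u : Fin n → Fin n → ℝ := fun a b => realEntry A a b - lam + (0 - 0) with hu
  have hclosed (k : Fin n) (c : Walk (digraph A) k k) : c.realWeight u ≤ 0 := by
    refine Walk.realWeight_nonpos_of_isCycle (fun k c hc => ?_) c
    have h1 := realWeight_le_of_isCycle hlam c hc
    have h2 := c.realWeight_normalize (realEntry A) lam fun _ => 0
    rw [hu, h2]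
    linarith
  set K : ℝ := ∑ a, ∑ b, |u a b| with hK
  have hK0 : 0 ≤ K := Finset.sum_nonneg fun _ _ => Finset.sum_nonneg fun _ _ => abs_nonneg _
  have huK (a b : Fin n) : u a b ≤ K := by
    refine (le_abs_self _).trans ((Finset.single_le_sum (f := fun b => |u a b|)
      (fun _ _ => abs_nonneg _) (Finset.mem_univ b)).trans ?_)
    exact Finset.single_le_sum (f := fun a => ∑ b, |u a b|)
      (fun _ _ => Finset.sum_nonneg fun _ _ => abs_nonneg _) (Finset.mem_univ a)
  have hbdd (a : Fin n) : BddAbove {r | ∃ (b : Fin n) (p : Walk (digraph A) a b),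
      p.realWeight u = r} := by
    refine ⟨n * K, ?_⟩
    rintro _ ⟨b, p, rfl⟩
    obtain ⟨q, hq, hpq, -⟩ := p.exists_isPath hclosed
    refine hpq.trans ((q.realWeight_le (v := fun _ _ => K) fun e _ => huK _ _).trans ?_)
    rw [Walk.realWeight_const]
    exact mul_le_mul_of_nonneg_right (by exact_mod_cast hq.length_lt.le) hK0
  -- The potential at `a` is the supremum of the weights of the walks leaving `a`. It is finite,
  -- since paths suffice when closed walks are nonpositive.
  refine ⟨fun a => sSup {r | ∃ (b : Fin n) (p : Walk (digraph A) a b), p.realWeight u = r},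
    fun a b hab => ?_⟩
  have h : sSup {r | ∃ (c : Fin n) (p : Walk (digraph A) b c), p.realWeight u = r} ≤
      sSup {r | ∃ (c : Fin n) (p : Walk (digraph A) a c), p.realWeight u = r} - u a b := by
    refine csSup_le ⟨_, b, Walk.nil b, rfl⟩ ?_
    rintro _ ⟨c, p, rfl⟩
    have := le_csSup (hbdd a) ⟨c, Walk.cons hab p, rfl⟩
    rw [Walk.realWeight_cons] at this
    linarith
  simp only [hu, sub_zero, add_zero] at h ⊢
  linarith

theorem criticalGraph_le (A : Matrix (Fin n) (Fin n) (WithBot ℝ)) :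
    criticalGraph A ≤ digraph A := by
  rintro a b ⟨k, p, -, -, h⟩
  exact p.adj_of_mem_edges h

theorem criticalGraph_sameScc {a b : Fin n} (h : (criticalGraph A).Adj a b) :
    SameScc (criticalGraph A) a b := by
  obtain ⟨k, p, h1, h2, h3⟩ := h
  obtain ⟨p', hp', -⟩ := p.exists_transfer (H := criticalGraph A)
    fun e he => ⟨k, p, h1, h2, he⟩
  rw [← hp'] at h3
  obtain ⟨q, r, hab, -⟩ := p'.exists_split_edge h3
  exact ⟨⟨Walk.cons hab (Walk.nil b)⟩, ⟨r.append q⟩⟩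

theorem exists_maxCycleMean_eq_coe {z : Fin n} (hz : IsNode (criticalGraph A) z) :
    ∃ lam : ℝ, maxCycleMean A = lam := by
  obtain ⟨w, ⟨k, p, h1, h2, -⟩ | ⟨k, p, h1, h2, -⟩⟩ := hz <;>
  · refine Exists.imp (fun _ h => h.symm) (WithBot.ne_bot_iff_exists.1 fun h => ?_)
    rw [weight_eq_coe_realEntry, h, ← Nat.succ_pred_eq_of_pos h1, succ_nsmul, WithBot.add_bot] at h2
    exact WithBot.coe_ne_bot h2

/-- Rescaled weights that do not exceed the maximum cycle mean are normalized. -/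
theorem isNormalized_of_potential (hlam : maxCycleMean A = lam) {x : Fin n → ℝ}
    (hx : ∀ a b, (digraph A).Adj a b → realEntry A a b - lam + (x b - x a) ≤ 0) :
    IsNormalized (digraph A) (criticalGraph A)
      (fun a b => realEntry A a b - lam + (x b - x a)) := by
  have hle {a b : Fin n} (p : Walk (digraph A) a b) :
      p.realWeight (fun a b => realEntry A a b - lam + (x b - x a)) ≤ 0 := by
    have := p.realWeight_le (u := fun a b => realEntry A a b - lam + (x b - x a))
      (v := fun _ _ => 0) fun e he => hx _ _ (p.adj_of_mem_edges he)
    rwa [Walk.realWeight_const, mul_zero] at this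
  refine ⟨criticalGraph_le A, fun k c => hle c, ?_, fun a b h => criticalGraph_sameScc h⟩
  rintro a b ⟨k, p, h1, h2, h3⟩
  rw [weight_eq_coe_realEntry, hlam, ← WithBot.coe_nsmul, WithBot.coe_inj, nsmul_eq_mul] at h2
  -- Nonpositive terms around a critical closed walk sum to zero, so each of them is zero.
  have h4 := p.realWeight_normalize (realEntry A) lam x
  obtain ⟨q, r, hab, rfl⟩ := p.exists_split_edge h3
  rw [h2, Walk.realWeight_append, Walk.realWeight_cons] at h4
  have := hle q
  have := hle r
  have := hx a b hab
  dsimp only at h4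
  linarith

end Visualization

/-! ### CSR terms -/

section CSR

variable {n : ℕ} {A : Matrix (Fin n) (Fin n) (WithBot ℝ)} {G : Digraph (Fin n)} {lam : ℝ}

theorem scale_inv_apply (hlam : maxCycleMean A = lam) {i j : Fin n} (h : (digraph A).Adj i j) :
    inv (maxCycleMean A) + A i j = ((realEntry A i j - lam : ℝ) : WithBot ℝ) := by
  rw [hlam, ← coe_realEntry h, inv, WithBot.map_coe, ← WithBot.coe_add]
  congr 1
  ring

/-- Walks of length a multiple of `g` and powers of `g`-th powers. -/
theorem weight_le_pow_pow (A : Matrix (Fin n) (Fin n) (WithBot ℝ)) (g m : ℕ) {H : Digraph (Fin n)}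
    {i j : Fin n} (p : Walk H i j) (hp : p.length = g * m) :
    weight A p ≤ pow (pow A g) m i j := by
  induction m generalizing j with
  | zero =>
    cases p with
    | nil => simp [pow, one]
    | cons => simp at hp
  | succ m ih =>
    obtain ⟨k, q, r, rfl, hq⟩ := p.exists_split_length (s := g * m) (by rw [hp, mul_add]; omega)
    have hr : r.length = g := by
      rw [Walk.length_append, hq, mul_add] at hp
      omega
    rw [weight_append]
    refine (add_le_add (ih q hq) (weight_le_pow A r)).trans ?_
    rw [hr]
    exact add_le_mul (pow (pow A g) m) (pow A g) i k j

theorem exists_walk_of_pow_pow_ne_bot (g m : ℕ) {i j : Fin n} (h : pow (pow A g) m i j ≠ ⊥) :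
    ∃ p : Walk (digraph A) i j, p.length = g * m ∧ weight A p = pow (pow A g) m i j := by
  induction m generalizing j with
  | zero =>
    by_cases hij : i = j
    · subst hij
      exact ⟨Walk.nil i, rfl, by simp [pow, one]⟩
    · simp [pow, one, hij] at h
  | succ m ih =>
    obtain ⟨k, hk⟩ := exists_mul_eq (pow (pow A g) m) (pow A g) i j
    change pow (pow A g) (m + 1) i j = _ at hk
    rw [hk] at h ⊢
    rw [Ne, WithBot.add_eq_bot, not_or] at h
    obtain ⟨p, hp, hw⟩ := ih h.1
    obtain ⟨q, hq, hw'⟩ := exists_walk_of_pow_ne_bot h.2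
    exact ⟨p.append q, by simp [hp, hq]; ring, by simp [hw, hw']⟩

theorem weight_scale_inv (hlam : maxCycleMean A = lam) {i j : Fin n}
    (p : Walk (digraph A) i j) : weight (scale (inv (maxCycleMean A)) A) p =
      ((p.realWeight (realEntry A) - p.length * lam : ℝ) : WithBot ℝ) := by
  have h := p.realWeight_normalize (realEntry A) lam fun _ => 0
  simp only [sub_zero, add_zero] at h
  rw [← h]
  exact weight_eq_coe p fun e he => scale_inv_apply hlam (p.adj_of_mem_edges he)

theorem digraph_scale_inv_le (A : Matrix (Fin n) (Fin n) (WithBot ℝ)) :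
    digraph (scale (inv (maxCycleMean A)) A) ≤ digraph A := by
  intro a b h
  have h' : inv (maxCycleMean A) + A a b ≠ ⊥ := h
  rw [Ne, WithBot.add_eq_bot, not_or] at h'
  exact h'.2

theorem weight_congr_edges {H K : Digraph (Fin n)} {i j k l : Fin n} {p : Walk H i j}
    {q : Walk K k l} (h : p.edges = q.edges) : weight A p = weight A q := by
  unfold weight
  rw [h]

theorem exists_walk_of_star_term (hlam : maxCycleMean A = lam) {g m : ℕ} {i j : Fin n}
    (h : pow (pow (scale (inv (maxCycleMean A)) A) g) m i j ≠ ⊥) :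
    ∃ p : Walk (digraph A) i j, p.length = g * m ∧
      pow (pow (scale (inv (maxCycleMean A)) A) g) m i j =
        ((p.realWeight (realEntry A) - p.length * lam : ℝ) : WithBot ℝ) := by
  obtain ⟨p, hp, hw⟩ := exists_walk_of_pow_pow_ne_bot g m h
  obtain ⟨q, hq, hl, -⟩ := p.exists_map (digraph_scale_inv_le A)
  exact ⟨q, hl.trans hp, by rw [← hw, ← weight_congr_edges hq, weight_scale_inv hlam]⟩

theorem le_csrM (hlam : maxCycleMean A = lam) {i j : Fin n} (p : Walk (digraph A) i j)
    (hp : cyclicity G ∣ p.length) :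
    ((p.realWeight (realEntry A) - p.length * lam : ℝ) : WithBot ℝ) ≤ csrM A G i j := by
  obtain ⟨x, hx⟩ := exists_potential hlam
  have hbdd : BddAbove (Set.range fun m : ℕ =>
      pow (pow (scale (inv (maxCycleMean A)) A) (cyclicity G)) m i j) := by
    -- The potential bounds every term of the star, so its supremum is a genuine one.
    refine ⟨((x i - x j : ℝ) : WithBot ℝ), ?_⟩
    rintro _ ⟨m, rfl⟩
    dsimp only
    by_cases h : pow (pow (scale (inv (maxCycleMean A)) A) (cyclicity G)) m i j = ⊥
    · rw [h]; exact bot_le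
    · obtain ⟨q, -, hw⟩ := exists_walk_of_star_term hlam h
      rw [hw, WithBot.coe_le_coe]
      have h1 := q.realWeight_normalize (realEntry A) lam x
      have h2 := q.realWeight_le (u := fun a b => realEntry A a b - lam + (x b - x a))
        (v := fun _ _ => 0) fun e he => hx _ _ (q.adj_of_mem_edges he)
      rw [Walk.realWeight_const, h1] at h2
      linarith
  obtain ⟨m, hm⟩ := hp
  rw [← weight_scale_inv hlam]
  exact (weight_le_pow_pow _ _ m p hm).trans (le_ciSup hbdd m)

theorem exists_walk_of_lt_csrM (hlam : maxCycleMean A = lam) {i j : Fin n} {c : ℝ}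
    (h : (c : WithBot ℝ) < csrM A G i j) : ∃ p : Walk (digraph A) i j, cyclicity G ∣ p.length ∧
      c < p.realWeight (realEntry A) - p.length * lam := by
  obtain ⟨m, hm⟩ := exists_lt_of_lt_ciSup
    (f := fun m : ℕ => pow (pow (scale (inv (maxCycleMean A)) A) (cyclicity G)) m i j) h
  obtain ⟨p, hp, hw⟩ := exists_walk_of_star_term hlam (bot_le.trans_lt hm).ne'
  exact ⟨p, ⟨m, hp⟩, by rwa [hw, WithBot.coe_lt_coe] at hm⟩

theorem le_pow_csrS (hlam : maxCycleMean A = lam) (hG : G ≤ digraph A) {i j : Fin n}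
    (p : Walk G i j) : ((p.realWeight (realEntry A) - p.length * lam : ℝ) : WithBot ℝ) ≤
      pow (csrS A G) p.length i j := by
  have h := p.realWeight_normalize (realEntry A) lam fun _ => 0
  simp only [sub_zero, add_zero] at h
  rw [← h, ← weight_eq_coe (A := csrS A G)]
  · exact weight_le_pow _ p
  · intro e he
    have hadj := p.adj_of_mem_edges he
    rw [← scale_inv_apply hlam (hG hadj)]
    simp [csrS, hadj]

theorem exists_walk_of_pow_csrS (hlam : maxCycleMean A = lam) {t : ℕ} (hG : G ≤ digraph A)
    {i j : Fin n} (h : pow (csrS A G) t i j ≠ ⊥) : ∃ p : Walk G i j, p.length = t ∧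
      pow (csrS A G) t i j =
        ((p.realWeight (realEntry A) - p.length * lam : ℝ) : WithBot ℝ) := by
  obtain ⟨p, hp, hw⟩ := exists_walk_of_pow_ne_bot h
  have hle : digraph (csrS A G) ≤ G := by
    intro a b hab
    by_contra hn
    exact hab (by simp [csrS, hn])
  obtain ⟨q, hq, hl, -⟩ := p.exists_map hle
  refine ⟨q, hl.trans hp, ?_⟩
  have h := q.realWeight_normalize (realEntry A) lam fun _ => 0
  simp only [sub_zero, add_zero] at h
  rw [← hw, ← weight_congr_edges hq, ← h]
  refine weight_eq_coe q fun e he => ?_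
  have hadj := q.adj_of_mem_edges he
  rw [← scale_inv_apply hlam (hG hadj)]
  simp [csrS, hadj]

/-- Closed walks of `G` are closed walks of the critical graph, so the critical cyclicity divides
that of the component of `G`. Walks counted by `csrM` therefore have length zero modulo the critical
cyclicity. -/
theorem sccCyclicity_dvd_cyclicity (hG : IsRepresenting G (criticalGraph A)) {k : Fin n}
    (hk : IsNode G k) : sccCyclicity (criticalGraph A) k ∣ cyclicity G := by
  classical
  have h1 : sccCyclicity G k ∣ cyclicity G := by
    unfold cyclicity
    exact Finset.dvd_lcm (by simpa using hk)
  refine dvd_trans (dvd_sccCyclicity (exists_closedWalk_of_isNode hG.2.1 hk) fun c => ?_) h1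
  obtain ⟨d, -, hd, -⟩ := c.exists_map hG.1
  rw [← hd]
  refine sccCyclicity_dvd_length (exists_closedWalk_of_isNode
    (fun a b h => criticalGraph_sameScc h) ?_) d
  obtain ⟨w, hw⟩ := hk
  exact ⟨w, hw.imp (fun h => hG.1 h) fun h => hG.1 h⟩

theorem cyclicity_pos (hG : ∀ a b, G.Adj a b → SameScc G a b) : 0 < cyclicity G := by
  classical
  unfold cyclicity
  refine Nat.pos_of_ne_zero fun h => ?_
  obtain ⟨k, hk, h0⟩ := Finset.lcm_eq_zero_iff.1 h
  exact (sccCyclicity_pos (exists_closedWalk_of_isNode hG (Finset.mem_filter.1 hk).2)).ne' h0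

/-- In a completely reducible digraph one can walk forever, and always return. -/
theorem exists_walk_of_isNode {V : Type} {G : Digraph V} (hG : ∀ a b, G.Adj a b → SameScc G a b)
    {k : V} (hk : IsNode G k) (r : ℕ) :
    ∃ (l : V) (p : Walk G k l) (_ : Walk G l k), p.length = r := by
  obtain ⟨c, hc⟩ := exists_closedWalk_of_isNode hG hk
  obtain ⟨d, hd, -⟩ := c.exists_repeat r
  obtain ⟨l, p, q, -, hp⟩ := d.exists_split_length (s := r)
    (by rw [hd]; exact Nat.le_mul_of_pos_right r hc)
  exact ⟨l, p, q, hp⟩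

/-- Walks through the critical graph are dominated by the CSR term. -/
theorem le_csr (hlam : maxCycleMean A = lam) (hG : IsRepresenting G (criticalGraph A))
    {i j k : Fin n} (hk : IsNode (criticalGraph A) k) (p : Walk (digraph A) i k)
    (q : Walk (digraph A) k j) {t : ℕ} (ht : p.length + q.length = t) :
    ((p.realWeight (realEntry A) + q.realWeight (realEntry A) : ℝ) : WithBot ℝ) ≤
      t • maxCycleMean A + mul (mul (csrC A G) (pow (csrS A G) t)) (csrR A G) i j := by
  obtain ⟨x, hx⟩ := exists_potential hlam
  have hN := isNormalized_of_potential hlam hx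
  obtain ⟨k', hk', ⟨⟨a⟩, ⟨b⟩⟩, -⟩ := hG.2.2 k hk
  have hγ := cyclicity_pos hG.2.1
  set γ := cyclicity G with hγdef
  have hGD : G ≤ digraph A := hG.1.trans (criticalGraph_le A)
  -- This length makes the walk to `k₁` as long as `γ` times `p.length + a.length`, as `C` requires.
  -- A further `t` steps in `G` then serve for `S^t`.
  obtain ⟨k₁, w₁, v₁, hw₁⟩ := exists_walk_of_isNode hG.2.1 hk' ((p.length + a.length) * (γ - 1))
  have hk₁ : IsNode G k₁ := hk'.of_sameScc ⟨⟨w₁⟩, ⟨v₁⟩⟩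
  obtain ⟨l, w₂, v₂, hw₂⟩ := exists_walk_of_isNode hG.2.1 hk₁ t
  have hl : IsNode G l := hk₁.of_sameScc ⟨⟨w₂⟩, ⟨v₂⟩⟩
  obtain ⟨w₁', -, hw₁', -⟩ := w₁.exists_map hG.1
  obtain ⟨v₁', -, hv₁', -⟩ := v₁.exists_map hG.1
  obtain ⟨w₂', hw₂e, hw₂', -⟩ := w₂.exists_map hG.1
  obtain ⟨v₂', -, hv₂', -⟩ := v₂.exists_map hG.1
  -- Repeating the round trip `γ - 1` more times makes the whole insertion a multiple of `γ`. As the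
  -- `S` part has length `t`, the lengths of the `C` and `R` parts together are then divisible by
  -- `γ`, and so is the `R` part.
  obtain ⟨d, hd, -⟩ := ((a.append (w₁'.append (w₂'.append (v₂'.append
    (v₁'.append b))))) : Walk (criticalGraph A) k k).exists_repeat (γ - 1)
  obtain ⟨α, hα, hα0⟩ := hN.exists_lift (a.append w₁')
  obtain ⟨β, hβ, hβ0⟩ := hN.exists_lift (v₂'.append (v₁'.append (b.append d)))
  obtain ⟨σ, hσ, hσ0⟩ := hN.exists_lift w₂'
  simp only [Walk.length_append] at hd hα hβ
  obtain ⟨g, hg⟩ : ∃ g, γ = g + 1 := ⟨γ - 1, by omega⟩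
  have hC : γ ∣ (p.append α).length := by
    refine ⟨p.length + a.length, ?_⟩
    rw [Walk.length_append, hα, hw₁', hw₁, hg, Nat.add_sub_cancel]
    ring
  have hR : γ ∣ (β.append q).length := by
    refine (Nat.dvd_add_right hC).1 ⟨a.length + (w₁'.length + (w₂'.length + (v₂'.length +
      (v₁'.length + b.length)))), ?_⟩
    rw [Walk.length_append, Walk.length_append, hα, hβ, hd, hw₂', hw₂, ← ht, hg,
      Nat.add_sub_cancel]
    ring
  have h1 := le_csrM (G := G) hlam (p.append α) hC
  have h2 := le_csrM (G := G) hlam (β.append q) hR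
  have h3 := le_pow_csrS hlam hGD w₂
  rw [hw₂] at h3
  have h4 : csrC A G i k₁ + pow (csrS A G) t k₁ l ≤ mul (csrC A G) (pow (csrS A G) t) i l :=
    add_le_mul _ _ _ _ _
  have h5 : mul (csrC A G) (pow (csrS A G) t) i l + csrR A G l j ≤
      mul (mul (csrC A G) (pow (csrS A G) t)) (csrR A G) i j := add_le_mul _ _ _ _ _
  have hCe : csrC A G i k₁ = csrM A G i k₁ := by simp [csrC, hk₁]
  have hRe : csrR A G l j = csrM A G l j := by simp [csrR, hl]
  rw [hCe] at h4
  rw [hRe] at h5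
  refine le_trans ?_ (add_le_add_right ((add_le_add_left ((add_le_add h1 h3).trans h4)
    (csrM A G l j)).trans h5) _)
  refine le_trans ?_ (add_le_add_right (add_le_add_right h2 _) _)
  rw [hlam, ← WithBot.coe_nsmul, ← WithBot.coe_add, ← WithBot.coe_add, ← WithBot.coe_add,
    WithBot.coe_le_coe]
  have e1 := (p.append α).realWeight_normalize (realEntry A) lam x
  have e2 := (β.append q).realWeight_normalize (realEntry A) lam x
  have e3 := w₂'.realWeight_normalize (realEntry A) lam x
  have e4 := p.realWeight_normalize (realEntry A) lam x
  have e5 := q.realWeight_normalize (realEntry A) lam x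
  have e6 : w₂'.realWeight (realEntry A) = w₂.realWeight (realEntry A) := by
    unfold Walk.realWeight; rw [hw₂e]
  have e7 : w₂'.realWeight (fun a b => realEntry A a b - lam + (x b - x a)) = 0 := by
    rw [w₂'.realWeight_congr (v := fun _ _ => 0), Walk.realWeight_const, mul_zero]
    exact fun e he => hN.eq_zero _ _ (w₂'.adj_of_mem_edges he)
  rw [Walk.realWeight_append, hα0, add_zero] at e1
  rw [Walk.realWeight_append, hβ0, zero_add] at e2
  rw [e6, hw₂', hw₂, e7] at e3
  rw [e4] at e1
  rw [e5] at e2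
  rw [nsmul_eq_mul]
  have ht' : (t : ℝ) = p.length + q.length := by rw [← ht]; push_cast; ring
  rw [ht'] at e3 ⊢
  linarith

/-- The CSR term is dominated by the matrix power as soon as walks through the critical graph can
be given any length in their class. -/
theorem csr_le (hlam : maxCycleMean A = lam) (hG : IsRepresenting G (criticalGraph A)) {t : ℕ}
    (ht : ∀ (u : Fin n → Fin n → ℝ) (i j : Fin n) (c : ℝ) (z : Fin n) (l : ℕ),
      IsNormalized (digraph A) (criticalGraph A) u → IsNode (criticalGraph A) z →
      WalkThrough (digraph A) u i j c z l → l ≡ t [MOD sccCyclicity (criticalGraph A) z] →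
      ∃ w, IsNode (criticalGraph A) w ∧ WalkThrough (digraph A) u i j c w t) (i j : Fin n) :
    t • maxCycleMean A + mul (mul (csrC A G) (pow (csrS A G) t)) (csrR A G) i j ≤
      pow A t i j := by
  by_contra! hlt
  obtain ⟨x, hx⟩ := exists_potential hlam
  have hN := isNormalized_of_potential hlam hx
  have hGD : G ≤ digraph A := hG.1.trans (criticalGraph_le A)
  obtain ⟨l, hl⟩ := exists_mul_eq (mul (csrC A G) (pow (csrS A G) t)) (csrR A G) i j
  obtain ⟨k, hk⟩ := exists_mul_eq (csrC A G) (pow (csrS A G) t) i l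
  rw [hl, hk] at hlt
  have hne := (bot_le.trans_lt hlt).ne'
  simp only [Ne, WithBot.add_eq_bot, not_or] at hne
  obtain ⟨-, ⟨hC, hS⟩, hR⟩ := hne
  have hkG : IsNode G k := by
    by_contra h
    exact hC (by simp [csrC, h])
  have hlG : IsNode G l := by
    by_contra h
    exact hR (by simp [csrR, h])
  have hCe : csrC A G i k = csrM A G i k := by simp [csrC, hkG]
  have hRe : csrR A G l j = csrM A G l j := by simp [csrR, hlG]
  rw [hCe] at hC hlt
  rw [hRe] at hR hlt
  obtain ⟨s, hs, hsw⟩ := exists_walk_of_pow_csrS hlam hGD hS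
  obtain ⟨α, hα⟩ := WithBot.ne_bot_iff_exists.1 hC
  obtain ⟨β, hβ⟩ := WithBot.ne_bot_iff_exists.1 hR
  set σ := s.realWeight (realEntry A) - s.length * lam with hσ
  rw [hsw, ← hα, ← hβ, hlam, ← WithBot.coe_nsmul, ← WithBot.coe_add, ← WithBot.coe_add,
    ← WithBot.coe_add, nsmul_eq_mul] at hlt
  -- A real number below the CSR value is needed even when the entry of `A^t` is `-∞`.
  obtain ⟨y, hy, hylt⟩ : ∃ y : ℝ, pow A t i j ≤ y ∧ y < t * lam + (α + σ + β) := by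
    rcases eq_or_ne (pow A t i j) ⊥ with h | h
    · exact ⟨t * lam + (α + σ + β) - 1, by rw [h]; exact bot_le, by linarith⟩
    · obtain ⟨y, hy⟩ := WithBot.ne_bot_iff_exists.1 h
      exact ⟨y, hy.ge, by rwa [← hy, WithBot.coe_lt_coe] at hlt⟩
  -- The entries of `C` and `R` are suprema, which walks approximate; each of the two may lose half
  -- of the gap.
  set δ := (t * lam + (α + σ + β) - y) / 2 with hδ
  have hδ0 : 0 < δ := by rw [hδ]; linarith
  obtain ⟨p, hp, hpw⟩ := exists_walk_of_lt_csrM (G := G) (i := i) (j := k) (c := α - δ) hlam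
    (by rw [← hα, WithBot.coe_lt_coe]; linarith)
  obtain ⟨q, hq, hqw⟩ := exists_walk_of_lt_csrM (G := G) (i := l) (j := j) (c := β - δ) hlam
    (by rw [← hβ, WithBot.coe_lt_coe]; linarith)
  obtain ⟨s', hs'e, hs', -⟩ := s.exists_map hGD
  have hkc : IsNode (criticalGraph A) k := by
    obtain ⟨w, hw⟩ := hkG
    exact ⟨w, hw.imp (fun h => hG.1 h) fun h => hG.1 h⟩
  have hdvd := sccCyclicity_dvd_cyclicity hG hkG
  obtain ⟨w, -, p', q', hlen, hwt⟩ := ht _ i j _ k _ hN hkc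
    ⟨p, s'.append q, rfl, le_rfl⟩ (by
      rw [Walk.length_append, hs', hs]
      have h1 := (Nat.modEq_zero_iff_dvd).2 (hdvd.trans hp)
      have h2 := (Nat.modEq_zero_iff_dvd).2 (hdvd.trans hq)
      simpa using h1.add ((Nat.ModEq.refl t).add h2))
  have h1 := weight_le_pow A (p'.append q')
  rw [weight_eq_coe_realEntry, Walk.length_append, hlen] at h1
  have h2 := WithBot.coe_le_coe.1 (h1.trans hy)
  have e6 : s'.realWeight (realEntry A) = s.realWeight (realEntry A) := by
    unfold Walk.realWeight; rw [hs'e]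
  simp only [Walk.realWeight_normalize, Walk.realWeight_append, e6] at hwt h2
  rw [hs'] at hwt
  have hlen' : (t : ℝ) = p'.length + q'.length := by rw [← hlen]; push_cast; ring
  rw [hlen'] at hδ
  linarith

end CSR

theorem Walk.fst_mem_support {V : Type} {G : Digraph V} {i j : V} (p : Walk G i j) {e : V × V}
    (he : e ∈ p.edges) : e.1 ∈ p.support := by
  obtain ⟨q, r, h, rfl⟩ := p.exists_split_edge he
  exact (Walk.mem_support_append _ _).2 (Or.inl q.end_mem_support)

theorem Walk.snd_mem_support {V : Type} {G : Digraph V} {i j : V} (p : Walk G i j) {e : V × V}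
    (he : e ∈ p.edges) : e.2 ∈ p.support := by
  obtain ⟨q, r, h, rfl⟩ := p.exists_split_edge he
  refine (Walk.mem_support_append _ _).2 (Or.inr ?_)
  rw [Walk.support_cons]
  exact List.mem_cons_of_mem _ r.start_mem_support

/-! ### Deleting nodes -/

section Delete

variable {n : ℕ} {A : Matrix (Fin n) (Fin n) (WithBot ℝ)} {D : Set (Fin n)}

theorem pow_deleteNodes_le (t : ℕ) (i j : Fin n) : pow (deleteNodes A D) t i j ≤ pow A t i j := by
  by_cases h : pow (deleteNodes A D) t i j = ⊥
  · rw [h]; exact bot_le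
  · obtain ⟨p, hp, hw⟩ := exists_walk_of_pow_ne_bot h
    have hent (a b : Fin n) (hab : (digraph (deleteNodes A D)).Adj a b) :
        deleteNodes A D a b = A a b := by
      have h' : deleteNodes A D a b ≠ ⊥ := hab
      by_cases hD : a ∈ D ∨ b ∈ D
      · exact absurd (by simp [deleteNodes, hD]) h'
      · simp [deleteNodes, hD]
    have hweight : weight (deleteNodes A D) p = weight A p := by
      unfold weight
      rw [List.map_congr_left fun e he => hent _ _ (p.adj_of_mem_edges he)]
    rw [← hw, hweight, ← hp]
    exact weight_le_pow A p

theorem weight_le_pow_deleteNodes {i j : Fin n} (p : Walk (digraph A) i j)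
    (hp : ∀ w ∈ p.support, w ∉ D) : weight A p ≤ pow (deleteNodes A D) p.length i j := by
  have hweight : weight (deleteNodes A D) p = weight A p := by
    unfold weight
    rw [List.map_congr_left fun e he => ?_]
    simp [deleteNodes, hp _ (p.fst_mem_support he), hp _ (p.snd_mem_support he)]
  rw [← hweight]
  exact weight_le_pow _ p

end Delete

/-! ### The weak CSR expansion -/

section Expansion

variable {n : ℕ} {A : Matrix (Fin n) (Fin n) (WithBot ℝ)} {G : Digraph (Fin n)}

/-- At time `t`, walks through critical nodes can be given the length `t` without becoming
lighter. -/
def CanAdjust (A : Matrix (Fin n) (Fin n) (WithBot ℝ)) (t : ℕ) : Prop :=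
  ∀ (u : Fin n → Fin n → ℝ) (i j : Fin n) (c : ℝ) (z : Fin n) (l : ℕ),
    IsNormalized (digraph A) (criticalGraph A) u → IsNode (criticalGraph A) z →
    WalkThrough (digraph A) u i j c z l → l ≡ t [MOD sccCyclicity (criticalGraph A) z] →
    ∃ w, IsNode (criticalGraph A) w ∧ WalkThrough (digraph A) u i j c w t

/-- Every walk of length `t` through `D` is dominated by one through a critical node. -/
def IsDominated (A : Matrix (Fin n) (Fin n) (WithBot ℝ)) (D : Set (Fin n)) (t : ℕ) : Prop :=
  ∀ (i j : Fin n) (p : Walk (digraph A) i j), p.length = t → (∃ w ∈ p.support, w ∈ D) →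
    ∃ k, IsNode (criticalGraph A) k ∧
      WalkThrough (digraph A) (realEntry A) i j (p.realWeight (realEntry A)) k t

theorem csr_eq_bot_of_isEmpty (hG : ∀ k, ¬ IsNode G k) (t : ℕ) (i j : Fin n) :
    t • maxCycleMean A + mul (mul (csrC A G) (pow (csrS A G) t)) (csrR A G) i j = ⊥ := by
  obtain ⟨l, hl⟩ := exists_mul_eq (mul (csrC A G) (pow (csrS A G) t)) (csrR A G) i j
  rw [hl]
  simp [csrR, hG]

/-- A heaviest walk either meets `D` and is dominated through a critical node, or survives in the
deleted matrix. Without critical nodes the CSR term is `-∞`. -/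
theorem pow_eq_csr_add (hG : IsRepresenting G (criticalGraph A)) {D : Set (Fin n)} {t : ℕ}
    (ht : CanAdjust A t)
    (hdom : IsDominated A D t) :
    pow A t = add (scale (t • maxCycleMean A) (mul (mul (csrC A G) (pow (csrS A G) t))
      (csrR A G))) (pow (deleteNodes A D) t) := by
  ext1 i j
  change pow A t i j = max (t • maxCycleMean A + mul (mul (csrC A G) (pow (csrS A G) t))
    (csrR A G) i j) (pow (deleteNodes A D) t i j)
  refine le_antisymm ?_ (max_le ?_ (pow_deleteNodes_le t i j))
  · by_cases h : pow A t i j = ⊥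
    · rw [h]; exact bot_le
    · obtain ⟨p, hp, hw⟩ := exists_walk_of_pow_ne_bot h
      rw [← hw]
      by_cases hpD : ∃ w ∈ p.support, w ∈ D
      · obtain ⟨k, hk, q, r, hlen, hc⟩ := hdom i j p hp hpD
        obtain ⟨lam, hlam⟩ := exists_maxCycleMean_eq_coe hk
        refine le_max_of_le_left (le_trans ?_ (le_csr hlam hG hk q r hlen))
        rw [weight_eq_coe_realEntry]
        exact WithBot.coe_le_coe.2 hc
      · push Not at hpD
        refine le_max_of_le_right ?_
        rw [← hp]
        exact weight_le_pow_deleteNodes p hpD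
  · by_cases hk : ∃ k, IsNode (criticalGraph A) k
    · obtain ⟨k, hk⟩ := hk
      obtain ⟨lam, hlam⟩ := exists_maxCycleMean_eq_coe hk
      exact csr_le hlam hG ht i j
    · rw [csr_eq_bot_of_isEmpty]
      · exact bot_le
      · rintro k ⟨w, hw⟩
        exact hk ⟨k, w, hw.imp (fun h => hG.1 h) fun h => hG.1 h⟩

theorem isDominated_critical (t : ℕ) :
    IsDominated A {k | IsNode (criticalGraph A) k} t := by
  rintro i j p rfl ⟨w, hw, hwc⟩
  obtain ⟨q, r, rfl, -⟩ := p.exists_split hw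
  exact ⟨w, hwc, q, r, by simp, by simp⟩

end Expansion

/-! ### The Hartmann-Arguelles scheme -/

section HartmannArguelles

variable {n : ℕ} {A V : Matrix (Fin n) (Fin n) (WithBot ℝ)}

theorem haGraph_mono_edges {μ ν : WithBot ℝ} {i j : Fin n} (p : Walk (haGraph V μ) i j)
    (h : ∀ e ∈ p.edges, ν ≤ V e.1 e.2) : Nonempty (Walk (haGraph V ν) i j) := by
  obtain ⟨q, -⟩ := p.exists_transfer (H := haGraph V ν)
    fun e he => ⟨(p.adj_of_mem_edges he).1, h e he⟩
  exact ⟨q⟩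

/-- The threshold of a component can be raised to the least weight of an edge of a closed walk. -/
theorem exists_edge_threshold {μ : WithBot ℝ} {w k : Fin n} (hwk : w ≠ k)
    (h : SameScc (haGraph V μ) w k) :
    ∃ a b, V a b ≠ ⊥ ∧ μ ≤ V a b ∧ SameScc (haGraph V (V a b)) w k := by
  obtain ⟨⟨q⟩, ⟨r⟩⟩ := h
  have hne : (q.append r).edges.toFinset.Nonempty := by
    cases q with
    | nil => exact absurd rfl hwk
    | cons h q => exact ⟨_, List.mem_toFinset.2 (List.mem_cons_self ..)⟩
  obtain ⟨e, he, hmin⟩ := Finset.exists_min_image _ (fun e : Fin n × Fin n => V e.1 e.2) hne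
  have hadj := (q.append r).adj_of_mem_edges (List.mem_toFinset.1 he)
  refine ⟨e.1, e.2, hadj.1, hadj.2, haGraph_mono_edges q fun f hf => hmin f ?_,
    haGraph_mono_edges r fun f hf => hmin f ?_⟩ <;> simp [hf]

/-- Let `μ` be the largest level at which the walk meets the threshold component of a critical node.
With weights on closed walks capped at `μ` and then lowered by `μ`, critical edges and a detour to
that node become free, while the walk itself loses nothing to the cap. Adjusting the walk with its
detour for these weights gives the dominating walk. -/
theorem isDominated_hartmannArguelles (hV : IsMaxBalancing A V) {t : ℕ} (ht : CanAdjust A t) :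
    IsDominated A {i | ∃ k, IsNode (criticalGraph A) k ∧
      SameScc (haGraph V (haThreshold A V)) i k} t := by
  classical
  rintro i j p hpt ⟨w₀, hw₀, k₀, hk₀, hwk₀⟩
  by_cases hcrit : ∃ w ∈ p.support, IsNode (criticalGraph A) w
  · exact isDominated_critical t i j p hpt hcrit
  push Not at hcrit
  obtain ⟨⟨y, hy⟩, hVle, hVcrit, hcover⟩ := hV
  obtain ⟨lam, hlam⟩ := exists_maxCycleMean_eq_coe hk₀
  have hbot (a b : Fin n) : V a b ≠ ⊥ ↔ A a b ≠ ⊥ := by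
    rw [hy]
    simp [WithBot.add_eq_bot]
  have hdig : digraph A ≤ digraph V := fun a b h => (hbot a b).2 h
  set v : Fin n → Fin n → ℝ := fun a b => realEntry A a b - 0 + (y b - y a) with hv
  have hVv (a b : Fin n) (h : (digraph A).Adj a b) : V a b = (v a b : ℝ) := by
    rw [hy, ← coe_realEntry h, ← WithBot.coe_add, ← WithBot.coe_add]
    congr 1
    simp only [hv]
    ring
  -- the largest level at which the walk meets the component of a critical node
  set T : Finset (Fin n × Fin n) := Finset.univ.filter fun e => (digraph A).Adj e.1 e.2 ∧
    ∃ w ∈ p.support, ∃ k, IsNode (criticalGraph A) k ∧ SameScc (haGraph V (V e.1 e.2)) w k with hT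
  -- The walk avoids critical nodes, so `w ≠ k` and the level can be raised to an actual entry. A
  -- largest level then exists among finitely many.
  have hraise (μ : WithBot ℝ) (w k : Fin n) (hw : w ∈ p.support) (hk : IsNode (criticalGraph A) k)
      (h : SameScc (haGraph V μ) w k) : ∃ e ∈ T, μ ≤ v e.1 e.2 := by
    obtain ⟨a, b, hab, hμ, hs⟩ := exists_edge_threshold
      (by rintro rfl; exact hcrit w hw hk) h
    have hadj : (digraph A).Adj a b := (hbot a b).1 hab
    exact ⟨(a, b), by simp only [hT, Finset.mem_filter, Finset.mem_univ, true_and]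
                      exact ⟨hadj, w, hw, k, hk, hs⟩, by rwa [← hVv a b hadj]⟩
  obtain ⟨e₀, he₀, -⟩ := hraise _ _ _ hw₀ hk₀ hwk₀
  obtain ⟨e, he, hmax⟩ := Finset.exists_max_image T (fun e => v e.1 e.2) ⟨e₀, he₀⟩
  obtain ⟨heA, w, hw, k, hk, ⟨⟨q⟩, ⟨r⟩⟩⟩ := (Finset.mem_filter.1 he).2
  have heV := hVv _ _ heA
  set μ : ℝ := v e.1 e.2 with hμ
  have hbound (ν : WithBot ℝ) (w k : Fin n) (hw : w ∈ p.support)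
      (hk : IsNode (criticalGraph A) k) (h : SameScc (haGraph V ν) w k) : ν ≤ μ := by
    obtain ⟨f, hf, hνf⟩ := hraise ν w k hw hk h
    exact hνf.trans (WithBot.coe_le_coe.2 (hmax f hf))
  have hμlam : μ ≤ lam := by
    rw [← WithBot.coe_le_coe, ← heV, ← hlam]
    exact hVle _ _
  set Cyc : Fin n → Fin n → Prop := fun a b =>
    ∃ (k : Fin n) (c : Walk (digraph A) k k), (a, b) ∈ c.edges with hCyc
  have hcyc (f : Fin n × Fin n) (hf : f ∈ p.edges) (hfc : Cyc f.1 f.2) : v f.1 f.2 ≤ μ := by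
    obtain ⟨k', c, hc⟩ := hfc
    obtain ⟨c', hc', -⟩ := c.exists_map hdig
    obtain ⟨d, hd, hfd⟩ := c'.exists_isCycle_of_mem_edges (e := f) (hc'.symm ▸ hc)
    obtain ⟨m, d', -, hfd', hle⟩ := hcover f.1 f.2 ⟨_, d, hd, hfd⟩
    obtain ⟨d'', hd'', -⟩ := d'.exists_transfer (H := haGraph V (V f.1 f.2))
      fun e he => ⟨d'.adj_of_mem_edges he, hle e he⟩
    obtain ⟨z, hz, -⟩ := d''.exists_isCycle_of_mem_edges (e := f) (hd''.symm ▸ hfd')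
    have hfs := p.fst_mem_support hf
    rw [← WithBot.coe_le_coe, ← hVv _ _ (p.adj_of_mem_edges hf)]
    -- By the cover property, `f.1` lies on a closed walk of the threshold graph at the level of
    -- `f`. If its component contains a critical one, maximality of `μ` applies. Otherwise this
    -- level competes for `haThreshold A V`, which is at most `μ`.
    by_cases hex : ∃ k, IsNode (criticalGraph A) k ∧
        ∀ l, SameScc (criticalGraph A) k l → SameScc (haGraph V (V f.1 f.2)) f.1 l
    · obtain ⟨k', hk', hall⟩ := hex
      exact hbound _ _ _ hfs hk' (hall k' (SameScc.refl _ _))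
    · refine le_trans ?_ (hbound _ _ _ hw₀ hk₀ hwk₀)
      exact le_csSup ⟨maxCycleMean A, fun x hx => hx.1⟩ ⟨hVle _ _, f.1, ⟨z, hz.1⟩, hex⟩
  -- Edges on no closed walk may exceed `μ`. They are left uncapped, which does no harm to the sign
  -- of closed walks.
  set u : Fin n → Fin n → ℝ :=
    fun a b => (if Cyc a b then min (v a b) μ else v a b) - μ with hu
  have huv (a b : Fin n) : u a b ≤ v a b - μ := by
    simp only [hu]
    split_ifs
    · exact sub_le_sub_right (min_le_left _ _) _
    · exact le_rfl
  have hN : IsNormalized (digraph A) (criticalGraph A) u := by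
    refine ⟨criticalGraph_le A, fun k c => ?_, fun a b hab => ?_,
      fun a b h => criticalGraph_sameScc h⟩
    · have := c.realWeight_le (u := u) (v := fun _ _ => 0) fun f hf => by
        have hfc : Cyc f.1 f.2 := ⟨k, c, hf⟩
        simp only [hu, if_pos hfc]
        linarith [min_le_right (v f.1 f.2) μ]
      rwa [Walk.realWeight_const, mul_zero] at this
    · have hc : Cyc a b := by
        obtain ⟨k, c, -, -, h⟩ := hab
        exact ⟨k, c, h⟩
      have h1 := hVcrit a b hab
      rw [hVv a b (criticalGraph_le A hab), hlam, WithBot.coe_inj] at h1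
      simp only [hu, if_pos hc, h1, min_eq_right hμlam, sub_self]
  -- the detour from the walk to the critical node and back
  have hlift {a b : Fin n} (s : Walk (haGraph V (V e.1 e.2)) a b) : ∃ s' : Walk (digraph A) a b,
      s'.edges = s.edges ∧ s'.length = s.length := by
    obtain ⟨s', h1, h2, -⟩ := s.exists_map (H := digraph A) fun a b h =>
      (hbot a b).1 (show V a b ≠ ⊥ ∧ _ from h).1
    exact ⟨s', h1, h2⟩
  obtain ⟨q', hq', -⟩ := hlift q
  obtain ⟨r', hr', -⟩ := hlift r
  -- Edges of the detour lie on a closed walk and weigh at least `μ`, so the cap makes them exactly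
  -- `μ`.
  have hzero (f : Fin n × Fin n) (hf : f ∈ q'.edges ++ r'.edges) : u f.1 f.2 = 0 := by
    have hc : Cyc f.1 f.2 := ⟨w, q'.append r', by rwa [Walk.edges_append]⟩
    have hadj : (haGraph V (V e.1 e.2)).Adj f.1 f.2 := by
      rw [hq', hr', ← Walk.edges_append] at hf
      exact (q.append r).adj_of_mem_edges hf
    have h1 := hadj.2
    rw [hVv _ _ ((hbot _ _).1 hadj.1), heV, WithBot.coe_le_coe] at h1
    simp only [hu, if_pos hc, min_eq_right h1, sub_self]
  have hq0 : q'.realWeight u = 0 := by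
    rw [q'.realWeight_congr (v := fun _ _ => 0), Walk.realWeight_const, mul_zero]
    exact fun f hf => hzero f (List.mem_append_left _ hf)
  have hr0 : r'.realWeight u = 0 := by
    rw [r'.realWeight_congr (v := fun _ _ => 0), Walk.realWeight_const, mul_zero]
    exact fun f hf => hzero f (List.mem_append_right _ hf)
  have hγ := sccCyclicity_pos (exists_closedWalk_of_isNode hN.sameScc hk)
  set γ := sccCyclicity (criticalGraph A) k with hγdef
  -- With these repetitions the detour has length `γ * (q'.length + r'.length)` and keeps the length
  -- class of the walk.
  obtain ⟨d, hd, hd0, -⟩ := (q'.append r').exists_repeat (γ - 1)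
  obtain ⟨p₁, p₂, hp, -⟩ := p.exists_split hw
  have hpu : p.realWeight u = p.realWeight v - p.length * μ := by
    have h := p.realWeight_normalize v μ fun _ => 0
    simp only [sub_zero, add_zero] at h
    rw [← h]
    refine p.realWeight_congr fun f hf => ?_
    simp only [hu]
    split_ifs with hfc
    · rw [min_eq_left (hcyc f hf hfc)]
    · rfl
  obtain ⟨k', hk', a, b, hab, hle⟩ := ht u i j (p.realWeight u) k
    ((p₁.append q').length + (r'.append (d.append p₂)).length) hN hk ⟨_, _, rfl, by
      rw [hp]
      simp [hq0, hr0, hd0]⟩ (by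
      have h1 : (p₁.append q').length + (r'.append (d.append p₂)).length =
          t + γ * (q'.length + r'.length) := by
        rw [← hpt, hp]
        simp only [Walk.length_append, hd]
        obtain ⟨g, hg⟩ : ∃ g, γ = g + 1 := ⟨γ - 1, by omega⟩
        rw [hg, Nat.add_sub_cancel]
        ring
      rw [h1]
      simp [Nat.ModEq, ← hγdef])
  refine ⟨k', hk', a, b, hab, ?_⟩
  -- Returning to `A`: `u` lies below `v - μ` everywhere, with equality along `p`. Both walks have
  -- length `t` and the same ends, so `μ` and the potential cancel.
  have ha := a.realWeight_le (u := u) (v := fun a b => v a b - μ + (0 - 0))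
    fun f _ => by simpa using huv f.1 f.2
  have hb := b.realWeight_le (u := u) (v := fun a b => v a b - μ + (0 - 0))
    fun f _ => by simpa using huv f.1 f.2
  rw [Walk.realWeight_normalize _ v μ fun _ => 0] at ha hb
  have hlen : (t : ℝ) = a.length + b.length := by rw [← hab]; push_cast; ring
  have e1 := p.realWeight_normalize (realEntry A) 0 y
  have e2 := a.realWeight_normalize (realEntry A) 0 y
  have e3 := b.realWeight_normalize (realEntry A) 0 y
  change p.realWeight v = _ at e1
  change a.realWeight v = _ at e2
  change b.realWeight v = _ at e3
  rw [hpu, hpt, e1, hlen] at hle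
  rw [e2] at ha
  rw [e3] at hb
  linarith

end HartmannArguelles

/-! ### The bounds -/

section Nonneg

variable {n : ℕ} {D H : Digraph (Fin n)}

theorem one_le_circumference_of_isNode (hH : ∀ a b, H.Adj a b → SameScc H a b) (hHD : H ≤ D)
    {z : Fin n} (hz : IsNode H z) : 1 ≤ circumference D := by
  obtain ⟨c, hc⟩ := exists_closedWalk_of_isNode hH hz
  obtain ⟨w, p, hp, -⟩ := exists_cycle_of_closedWalk c hc
  obtain ⟨q, -, hq, hqs⟩ := p.exists_map hHD
  have h : q.IsCycle := ⟨hq ▸ hp.1, hqs ▸ hp.2⟩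
  exact h.1.trans_le (length_le_circumference h)

/-- For `m = 0` the expression is the cab driver's diameter plus one minus the circumference. -/
theorem bound_nonneg_of_one_le (m : ℕ) (h : 1 ≤ m → 1 ≤ circumference D) :
    0 ≤ ((m : ℤ) - 1) * ((circumference D : ℤ) - 1) + ((m : ℤ) + 1) * cabDriverDiameter D := by
  have h1 := circumference_le_cabDriverDiameter D
  rcases Nat.eq_zero_or_pos m with rfl | hm
  · push_cast
    omega
  · have h2 := h hm
    have h3 : 0 ≤ ((m : ℤ) - 1) * ((circumference D : ℤ) - 1) :=
      mul_nonneg (by omega) (by omega)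
    positivity

theorem exists_isNode_of_sup_pos [DecidablePred (IsNode H)] {f : Fin n → ℕ}
    (h : 1 ≤ (Finset.univ.filter fun i => IsNode H i).sup f) : ∃ z, IsNode H z := by
  by_contra! hn
  rw [Finset.filter_false_of_mem fun z _ => hn z] at h
  simp at h

end Nonneg

theorem isWeakCSRThreshold_of_forall {n : ℕ} {A B : Matrix (Fin n) (Fin n) (WithBot ℝ)}
    {G : Digraph (Fin n)} {T : ℕ} (hT : ∀ t, T ≤ t → pow A t =
      add (scale (t • maxCycleMean A) (mul (mul (csrC A G) (pow (csrS A G) t)) (csrR A G)))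
        (pow B t)) :
    ∃ T₁, IsWeakCSRThreshold A G B T₁ := by
  classical
  exact ⟨_, Nat.isLeast_find (p := fun T => ∀ t, T ≤ t → pow A t =
      add (scale (t • maxCycleMean A) (mul (mul (csrC A G) (pow (csrS A G) t)) (csrR A G)))
        (pow B t)) ⟨T, hT⟩⟩

end MaxPlus

/-! ### The theorem -/

open MaxPlus in
theorem theorem4p1 (n : ℕ) (A B : Matrix (Fin n) (Fin n) (WithBot ℝ)) (G : Digraph (Fin n))
    (hG : MaxPlus.IsRepresenting G (MaxPlus.criticalGraph A))
    (hB : B = MaxPlus.nachtigall A ∨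
      ∃ V, MaxPlus.IsMaxBalancing A V ∧ B = MaxPlus.hartmannArguelles A V) :
    ∃ T₁ : ℕ, MaxPlus.IsWeakCSRThreshold A G B T₁ ∧
      T₁ ≤ MaxPlus.wielandt n ∧
      (T₁ : ℤ) ≤ MaxPlus.maxGirth (MaxPlus.criticalGraph A) * ((n : ℤ) - 2) + n ∧
      (T₁ : ℤ) ≤ ((MaxPlus.maxGirth (MaxPlus.criticalGraph A) : ℤ) - 1) *
            ((MaxPlus.circumference (MaxPlus.digraph A) : ℤ) - 1) +
          ((MaxPlus.maxGirth (MaxPlus.criticalGraph A) : ℤ) + 1) *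
            MaxPlus.cabDriverDiameter (MaxPlus.digraph A) ∧
      (T₁ : ℤ) ≤ MaxPlus.maxCyclicity (MaxPlus.criticalGraph A) * ((n : ℤ) - 1) + n -
          MaxPlus.nodeCount (MaxPlus.criticalGraph A) +
          MaxPlus.roundedExplorationPenalty (MaxPlus.criticalGraph A) ∧
      (T₁ : ℤ) ≤ ((MaxPlus.maxCyclicity (MaxPlus.criticalGraph A) : ℤ) - 1) *
            ((MaxPlus.circumference (MaxPlus.digraph A) : ℤ) - 1) +
          ((MaxPlus.maxCyclicity (MaxPlus.criticalGraph A) : ℤ) + 1) *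
            MaxPlus.cabDriverDiameter (MaxPlus.digraph A) +
          MaxPlus.explorationPenalty (MaxPlus.criticalGraph A) := by
  classical
  have hscc : ∀ a b, (criticalGraph A).Adj a b → SameScc (criticalGraph A) a b :=
    fun a b h => criticalGraph_sameScc h
  have key (t : ℕ) (ht : CanAdjust A t) : pow A t =
      add (scale (t • maxCycleMean A) (mul (mul (csrC A G) (pow (csrS A G) t)) (csrR A G)))
        (pow B t) := by
    rcases hB with rfl | ⟨V, hV, rfl⟩
    · exact pow_eq_csr_add hG ht (isDominated_critical t)
    · exact pow_eq_csr_add hG ht (isDominated_hartmannArguelles hV ht)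
  obtain ⟨T₁, hT₁⟩ := isWeakCSRThreshold_of_forall (A := A) (B := B) (G := G) (T := wielandt n)
    fun t ht => key t fun u i j c z l hN hz h hl => hN.walkThrough_of_bounds hz h hl (Or.inl ht)
  -- The bounds are integers. Nonnegativity lets `b.toNat` stand for `b`, and minimality of `T₁`
  -- does the rest.
  have hle (b : ℤ) (hb : 0 ≤ b) (h : ∀ t : ℕ, b ≤ t → CanAdjust A t) : (T₁ : ℤ) ≤ b := by
    have h1 := hT₁.2 (show b.toNat ∈ _ from fun t ht => key t (h t (by omega)))
    omega
  have hcr {f : Fin n → ℕ} (h : 1 ≤ (Finset.univ.filter fun i =>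
      IsNode (criticalGraph A) i).sup f) : 1 ≤ circumference (digraph A) := by
    obtain ⟨z, hz⟩ := exists_isNode_of_sup_pos h
    exact one_le_circumference_of_isNode hscc (criticalGraph_le A) hz
  have hgirth : maxGirth (criticalGraph A) ≤ n := by
    unfold maxGirth
    refine Finset.sup_le fun k hk => ?_
    obtain ⟨w, p, hp, -, hpl⟩ := exists_girth_cycle
      (exists_closedWalk_of_isNode hscc (Finset.mem_filter.1 hk).2)
    exact hpl ▸ hp.length_le
  have hcyc : maxCyclicity (criticalGraph A) = 0 ∨ 1 ≤ n := by
    rcases Nat.eq_zero_or_pos n with rfl | hn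
    · exact Or.inl (by simp [maxCyclicity])
    · exact Or.inr hn
  have hcount : nodeCount (criticalGraph A) ≤ n := by
    unfold nodeCount
    exact (Finset.card_le_univ _).trans (by simp)
  refine ⟨T₁, hT₁, ?_, hle _ ?_ ?_, hle _ ?_ ?_, hle _ ?_ ?_, hle _ ?_ ?_⟩
  · exact hT₁.2 fun t ht => key t fun u i j c z l hN hz h hl =>
      hN.walkThrough_of_bounds hz h hl (Or.inl ht)
  · rcases Nat.lt_or_ge n 2 with hn | hn
    -- For `n ≤ 1` the factor `n - 2` is negative, but the greatest girth is at most `n`.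
    · interval_cases n <;> push_cast <;> omega
    · have : (0 : ℤ) ≤ maxGirth (criticalGraph A) * ((n : ℤ) - 2) :=
        mul_nonneg (by omega) (by omega)
      omega
  · exact fun t ht u i j c z l hN hz h hl =>
      hN.walkThrough_of_bounds hz h hl (Or.inr (Or.inl ht))
  · refine bound_nonneg_of_one_le _ fun h => ?_
    unfold maxGirth at h
    exact hcr (by convert h)
  · exact fun t ht u i j c z l hN hz h hl =>
      hN.walkThrough_of_bounds hz h hl (Or.inr (Or.inr (Or.inl ht)))
  · have : (0 : ℤ) ≤ maxCyclicity (criticalGraph A) * ((n : ℤ) - 1) := by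
      rcases hcyc with h | h
      · rw [h]; simp
      · exact mul_nonneg (by omega) (by omega)
    omega
  · exact fun t ht u i j c z l hN hz h hl =>
      hN.walkThrough_of_bounds hz h hl (Or.inr (Or.inr (Or.inr (Or.inl ht))))
  · refine add_nonneg (bound_nonneg_of_one_le _ fun h => ?_) (by omega)
    unfold maxCyclicity at h
    exact hcr (by convert h)
  · exact fun t ht u i j c z l hN hz h hl =>
      hN.walkThrough_of_bounds hz h hl (Or.inr (Or.inr (Or.inr (Or.inr ht))))
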